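/- Consider an undiscounted perfect-information two-player zero-sum stochastic game: a finite state set $S$; for each $i\in S$ a finite nonempty set $A_i$ of actions of MIN; for each $a\in A_i$ a finite nonempty set $B_{i,a}$ of actions of MAX; $E=\{(i,a,b): i\in S,\ a\in A_i,\ b\in B_{i,a}\}$; and for each $(i,a,b)\in E$ a reward and a probability vector $P_i^{ab}=(P_{ij}^{ab})_{j\in S}$. A pair of (stationary) policies $(\sigma,\tau)$ has the transition matrix $P^{\sigma\tau}$ with rows $P_i^{\sigma(i)\,\tau(i,\sigma(i))}$. For a state $c$, $M_{(c)}$ denotes $M$ with column $c$ (for a row vector: entry $c$) replaced by zero. Let $c\in S$ be such that the equation $\varphi^\star=e+\max_{\sigma,\tau}P^{\sigma\tau}_{(c)}\varphi^\star$ (with $e=(1,\dots,1)^\top$ and the maximum taken coordinatewise) has a solution $\varphi^\star\in\mathbb R^S$; it is then unique and $\varphi^\star_i$ is the maximal expected first hitting time of $c$ from $i$ over all pairs of policies. Let $H\ge\|\varphi^\star\|_\infty$ be given, put $\lambda:=1-1/H\in[0,1)$, and let $\delta\in(0,1)$. Machine model: a real RAM with unit-cost arithmetic operations, comparisons, logarithms,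 roundings up to an integer, memory accesses and loop-counter updates, which can sample in unit time from the probability vector $(\tilde P_i^{ab},\,1-\sum_{j\ne c}P_{ij}^{ab})$ on $(S\setminus\{c\})\cup\{\text{cemetery}\}$, where $i\neq c$ and $\tilde P_i^{ab}=(P_{ij}^{ab})_{j\neq c}$. Algorithm. For a game with sub-Markovian rows $P_i^{ab}$, discount factors $\gamma_i^{ab}\le\Gamma$, and operator $T_i(w)=\min_a\max_b\{\gamma_i^{ab}P_i^{ab}Lw+G_i^{ab}(w)\}$, with $L$ linear and each $G_i^{ab}$ affine, define the following procedures. * $\mathrm{ApxTransC}(u,M,i,a,b,\epsilon,\delta)$ returns the mean of $u$ over $m=\lceil\frac{2M^2}{\epsilon^2}\ln\frac2\delta\rceil$ independent samples from $P_i^{ab}$ completed by a cemetery, with $u=0$ at the cemetery (and returns $0$ if $m=0$). * $\mathrm{SApxVal}(w,w_0,x,\epsilon,\delta)$ sets $u=L(w-w_0)$, $M=\|L\|_\infty\|w-w_0\|_\infty$ and $\tilde Q_i^{ab}=\gamma_i^{ab}\bigl(x_i^{ab}+\mathrm{ApxTransC}(u,M,i,a,b,\epsilon,\delta/|E|)\bigr)+G_i^{ab}(w)$,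 and returns $\tilde w_i=\min_a\max_b\tilde Q_i^{ab}$ together with minimizing and maximizing policies. * $\mathrm{SRandVI}(w_0,J,\epsilon,\delta)$ computes the offsets $x_i^{ab}=P_i^{ab}Lw_0$ exactly, iterates $w_j=\mathrm{SApxVal}(w_{j-1},w_0,x,\epsilon,\delta/J)$ for $j=1,\dots,J$, and returns $w_J$ and its policies. * $\mathrm{SHighPrecisionRandVI}(\epsilon,\delta,\lambda,W,\Gamma,d_1,d_2)$ sets $K=\lceil\log_2(d_2W/\epsilon)\rceil$, $J=\lceil\frac{\log 4}{1-\lambda}\rceil$, $w_0=0$ and $\epsilon_k=W/2^k$, iterates $w_k=\mathrm{SRandVI}\bigl(w_{k-1},J,\frac{1-\lambda}{4d_1\Gamma}\epsilon_k,\delta/K\bigr)$ for $k=1,\dots,K$, and returns $w_K$ and its policies. Call $\mathrm{SHighPrecisionRandVI}(\tfrac14,\delta,\lambda,1,1,1,\tfrac1{1-\lambda})$ on the game on $S\setminus\{c\}$ with operator $T^m_i(w)=1+\max_{a,b}\tilde P_i^{ab}w$ (that is, $\gamma=1$, $L=\mathrm{Id}$, $G=1$, and one player who maximizes over the pairs $(a,b)$).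 Let $\varphi'_i$ ($i\ne c$) be the vector it returns, put $\varphi'_c=1+\max_{a,b}\sum_{j\neq c}P^{ab}_{cj}\varphi'_j$, and output $\varphi=2\varphi'$. **Theorem.** There are universal constants $C>0$ and $p\in\mathbb N$ such that, for all games, $c$, $H$, $\delta$ as above, with probability at least $1-\delta$ this algorithm outputs $\varphi\in\mathbb R_+^S$ with $$\varphi_i\ \ge\ 1+\max_{a\in A_i,\,b\in B_{i,a}}P^{ab}_{(c)i}\varphi\quad\text{for all } i\in S,\qquad \frac1{1-\lambda_\varphi}\le\frac2{1-\lambda}+\frac12\ \text{ where }\lambda_\varphi:=1-\frac1{\|\varphi\|_\infty},$$ and its running time is at most $C\,F\,(\log F)^p$, where $$F=\Bigl(|S||E|+\frac{|E|}{(1-\lambda)^5}\Bigr)\log\frac2\delta .$$ In other words the running time is $\tilde O\bigl((|S||E|+\frac{|E|}{(1-\lambda)^5})\log\frac2\delta\bigr)$; for $\delta\le\frac12$ one has $\log\frac2\delta\le2\log\frac1\delta$, so $\log\frac1\delta$ may be written instead. -/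

import Mathlib

/-! ### A real-RAM with a sampling oracle

`Prog V Q R α` is the type of programs that return an `α`. The type `V` is the type of machine
numbers; every algorithm below is written for an arbitrary `V`, so that it can handle numbers only
through the instructions. `Q` is the type of queries to the random oracle and `R` the type of its
answers. Every instruction costs one unit of time; `tick` is an instruction without numerical effect
(a memory access or the update of a loop counter). -/

inductive ArithOp : Type
  | add | sub | mul | div

inductive Prog (V Q R α : Type) : Type
  | ret (a : α) : Prog V Q R α
  | tick (k : Prog V Q R α) : Prog V Q R α
  | load (n : ℕ) (k : V → Prog V Q R α) : Prog V Q R α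
  | arith (o : ArithOp) (x y : V) (k : V → Prog V Q R α) : Prog V Q R α
  | ln (x : V) (k : V → Prog V Q R α) : Prog V Q R α
  | less (x y : V) (k : Bool → Prog V Q R α) : Prog V Q R α
  | roundUp (x : V) (k : ℕ → Prog V Q R α) : Prog V Q R α
  | query (q : Q) (k : R → Prog V Q R α) : Prog V Q R α

noncomputable def ArithOp.eval : ArithOp → ℝ → ℝ → ℝ
  | .add, x, y => x + y
  | .sub, x, y => x - y
  | .mul, x, y => x * y
  | .div, x, y => x / y

namespace Prog

def bind {V Q R α β : Type} : Prog V Q R α → (α → Prog V Q R β) → Prog V Q R β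
  | ret a, f => f a
  | tick k, f => tick (k.bind f)
  | load n k, f => load n fun x => (k x).bind f
  | arith o x y k, f => arith o x y fun z => (k z).bind f
  | ln x k, f => ln x fun z => (k z).bind f
  | less x y k, f => less x y fun t => (k t).bind f
  | roundUp x k, f => roundUp x fun m => (k m).bind f
  | query q k, f => query q fun r => (k r).bind f

instance instMonadProg {V Q R : Type} : Monad (Prog V Q R) where
  pure := ret
  bind := bind

/-- The joint law of the output and of the running time (number of executed instructions) over exact
real numbers, when a query `q` is answered by a fresh independent sample of `law q`. -/
noncomputable def run {Q R α : Type} (law : Q → PMF R) : Prog ℝ Q R α → PMF (α × ℕ)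
  | ret a => PMF.pure (a, 0)
  | tick k => (run law k).map fun z => (z.1, z.2 + 1)
  | load n k => (run law (k (n : ℝ))).map fun z => (z.1, z.2 + 1)
  | arith o x y k => (run law (k (o.eval x y))).map fun z => (z.1, z.2 + 1)
  | ln x k => (run law (k (Real.log x))).map fun z => (z.1, z.2 + 1)
  | less x y k => (run law (k (@decide (x < y) (Classical.dec _)))).map fun z => (z.1, z.2 + 1)
  | roundUp x k => (run law (k ⌈x⌉₊)).map fun z => (z.1, z.2 + 1)
  | query q k => (law q).bind fun r => (run law (k r)).map fun z => (z.1, z.2 + 1)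

section Instructions

variable {V Q R : Type}

/-- Load a natural number as a machine number. -/
def lit (n : ℕ) : Prog V Q R V := load n ret
def plus (x y : V) : Prog V Q R V := arith .add x y ret
def minus (x y : V) : Prog V Q R V := arith .sub x y ret
def times (x y : V) : Prog V Q R V := arith .mul x y ret
def divide (x y : V) : Prog V Q R V := arith .div x y ret
def logarithm (x : V) : Prog V Q R V := ln x ret
def isLess (x y : V) : Prog V Q R Bool := less x y ret
def ceiling (x : V) : Prog V Q R ℕ := roundUp x ret
def sample (q : Q) : Prog V Q R R := query q ret

/-- Read an entry of an array. -/
def read {ι : Type} (f : ι → V) (i : ι) : Prog V Q R V := tick (ret (f i))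

/-- Overwrite an entry of an array. -/
def write {ι : Type} [DecidableEq ι] {β : ι → Type} (f : ∀ i, β i) (i : ι) (v : β i) :
    Prog V Q R (∀ i, β i) := tick (ret (Function.update f i v))

/-- `for i in l do s := body s i`, one unit of time per turn for the loop counter. -/
def forEach {ι σ : Type} : List ι → σ → (σ → ι → Prog V Q R σ) → Prog V Q R σ
  | [], s, _ => ret s
  | i :: l, s, body => tick ((body s i).bind fun s' => forEach l s' body)

/-- `m` turns of `s := body s`, one unit of time per turn for the loop counter. -/
def repeatN {σ : Type} : ℕ → σ → (σ → Prog V Q R σ) → Prog V Q R σ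
  | 0, s, _ => ret s
  | m + 1, s, body => tick ((body s).bind fun s' => repeatN m s' body)

/-- Fill an array indexed by the finite type `ι`; `blank` is the (overwritten) initial content. -/
noncomputable def tabulate {ι : Type} [Fintype ι] [DecidableEq ι] {β : ι → Type}
    (blank : ∀ i, β i) (entry : ∀ i, Prog V Q R (β i)) : Prog V Q R (∀ i, β i) :=
  forEach Finset.univ.toList blank fun arr i => do
    let v ← entry i
    write arr i v

/-- An array of numbers. -/
noncomputable def tabulateNum {ι : Type} [Fintype ι] [DecidableEq ι]
    (entry : ι → Prog V Q R V) : Prog V Q R (ι → V) := do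
  let zero ← lit 0
  tabulate (fun _ => zero) entry

/-- A maximizing index of a nonempty array. -/
noncomputable def argMax {ι : Type} [Fintype ι] [Nonempty ι] (q : ι → V) : Prog V Q R ι :=
  forEach Finset.univ.toList (Classical.arbitrary ι) fun best i => do
    let x ← read q best
    let y ← read q i
    let t ← isLess x y
    if t then pure i else pure best

/-- A minimizing index of a nonempty array. -/
noncomputable def argMin {ι : Type} [Fintype ι] [Nonempty ι] (q : ι → V) : Prog V Q R ι :=
  forEach Finset.univ.toList (Classical.arbitrary ι) fun best i => do
    let x ← read q best
    let y ← read q i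
    let t ← isLess y x
    if t then pure i else pure best

/-- The sum of `p j * z j`. -/
noncomputable def dot {ι : Type} [Fintype ι] (p z : ι → V) : Prog V Q R V := do
  let zero ← lit 0
  forEach Finset.univ.toList zero fun s j => do
    let x ← read p j
    let y ← read z j
    let t ← times x y
    plus s t

/-- The sup-norm of a vector. -/
noncomputable def supNorm {ι : Type} [Fintype ι] (z : ι → V) : Prog V Q R V := do
  let zero ← lit 0
  forEach Finset.univ.toList zero fun s j => do
    let x ← read z j
    let neg ← isLess x zero
    let y ← if neg then minus zero x else pure x
    let t ← isLess s y
    if t then pure y else pure s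

end Instructions

end Prog

/-! ### Games -/

/-- The admissible triples `(i, a, b)`: a state, an action of MIN, an answer of MAX. -/
abbrev Triple {S : Type} (A : S → Type) (B : ∀ i, A i → Type) : Type := Σ i, Σ a : A i, B i a

/-- The policies of MIN. -/
abbrev MinPolicy {S : Type} (A : S → Type) : Type := ∀ i, A i

/-- The policies of MAX, who observes the action of MIN. -/
abbrev MaxPolicy {S : Type} (A : S → Type) (B : ∀ i, A i → Type) : Type :=
  ∀ ia : (Σ i, A i), B ia.1 ia.2

/-- An undiscounted perfect information zero-sum stochastic game. -/
structure MeanPayoffGame (S : Type) [Fintype S] (A : S → Type) (B : ∀ i, A i → Type) where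
  P : Triple A B → S → ℝ
  P_nonneg : ∀ e j, 0 ≤ P e j
  P_sum : ∀ e, ∑ j, P e j = 1
  reward : Triple A B → ℝ

/-- The law on `S ∪ {cemetery}` attached to a subprobability vector; `none` is the cemetery. -/
noncomputable def cemeteryLaw {S : Type} [Fintype S] (p : S → ℝ) (h0 : ∀ j, 0 ≤ p j)
    (h1 : ∑ j, p j ≤ 1) : PMF (Option S) :=
  PMF.ofFintype
    (fun o => match o with
      | none => ENNReal.ofReal (1 - ∑ j, p j)
      | some j => ENNReal.ofReal (p j))
    (by
      rw [Fintype.sum_option, ← ENNReal.ofReal_sum_of_nonneg (fun j _ => h0 j),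
        ← ENNReal.ofReal_add (by linarith) (Finset.sum_nonneg fun j _ => h0 j)]
      simp)

/-! ### Variance reduced value iteration for structured games -/

section Algorithms

variable {S : Type} [Fintype S] [DecidableEq S]
  {A : S → Type} [∀ i, Fintype (A i)] [∀ i, DecidableEq (A i)] [∀ i, Nonempty (A i)]
  {B : ∀ i, A i → Type} [∀ i a, Fintype (B i a)] [∀ i a, DecidableEq (B i a)]
  [∀ i a, Nonempty (B i a)] {V : Type}

open Prog

/-- The input of the algorithms for the operator
`T i w = min_a max_b (γ * (P ⬝ L w) + G w)` (`γ`, `P`, `G` taken at `(i, a, b)`): tables of `P` and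
`γ`, programs that evaluate `L` and `G`, and the value of the operator norm of `L`. The oracle answers
a query `(i, a, b)` with a next state or with the cemetery `none`. -/
structure StructuredInput (V : Type) {S : Type} (A : S → Type) (B : ∀ i, A i → Type) where
  P : Triple A B → S → V
  γ : Triple A B → V
  L : (S → V) → Prog V (Triple A B) (Option S) (S → V)
  normL : V
  G : Triple A B → (S → V) → Prog V (Triple A B) (Option S) V

/-- What the iterations return: a vector and a pair of policies. -/
structure Iterate (V : Type) {S : Type} (A : S → Type) (B : ∀ i, A i → Type) where
  w : S → V
  σ : MinPolicy A
  τ : MaxPolicy A B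

/-- `ApxTransC(u, M, i, a, b, ε, δ)`: the empirical mean of `u` over `m = ⌈(2 M² / ε²) ln (2 / δ)⌉`
samples, with `u = 0` at the cemetery (over the reals the mean is `0 / 0 = 0` when `m = 0`, that is,
when `M = 0`). -/
def apxTransC (u : S → V) (M : V) (e : Triple A B) (ε δ : V) :
    Prog V (Triple A B) (Option S) V := do
  let zero ← lit 0
  let two ← lit 2
  let M2 ← times M M
  let x ← times two M2
  let ε2 ← times ε ε
  let y ← divide x ε2
  let z ← divide two δ
  let l ← logarithm z
  let v ← times y l
  let m ← ceiling v
  let total ← repeatN m zero fun s => do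
    let o ← sample e
    match o with
    | none => pure s
    | some j => do
      let uj ← read u j
      plus s uj
  let mV ← lit m
  divide total mV

/-- `SApxVal(w, w₀, x, ε, δ)`. -/
noncomputable def sApxVal (I : StructuredInput V A B) (w w0 : S → V) (x : Triple A B → V)
    (ε δ : V) : Prog V (Triple A B) (Option S) (Iterate V A B) := do
  let d ← tabulateNum fun i => do
    let p ← read w i
    let q ← read w0 i
    minus p q
  let nd ← supNorm d
  let M ← times I.normL nd
  let u ← I.L d
  let nE ← lit (Fintype.card (Triple A B))
  let δ' ← divide δ nE
  let Q ← tabulateNum fun e => do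
    let xe ← read x e
    let y ← apxTransC u M e ε δ'
    let s ← plus xe y
    let γe ← read I.γ e
    let t ← times γe s
    let g ← I.G e w
    plus t g
  let τ ← tabulate (β := fun ia : (Σ i, A i) => B ia.1 ia.2) (fun _ => Classical.arbitrary _)
    fun ia => argMax fun b => Q ⟨ia.1, ia.2, b⟩
  let wa ← tabulateNum fun ia : (Σ i, A i) => read Q ⟨ia.1, ia.2, τ ia⟩
  let σ ← tabulate (β := A) (fun _ => Classical.arbitrary _) fun i => argMin fun a => wa ⟨i, a⟩
  let w' ← tabulateNum fun i => read wa ⟨i, σ i⟩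
  pure ⟨w', σ, τ⟩

/-- `SRandVI(w₀, J, ε, δ)`; the policies before the first turn are arbitrary. -/
noncomputable def sRandVI (I : StructuredInput V A B) (w0 : S → V) (J : ℕ) (ε δ : V) :
    Prog V (Triple A B) (Option S) (Iterate V A B) := do
  let z ← I.L w0
  let x ← tabulateNum fun e => dot (I.P e) z
  let JV ← lit J
  let δ' ← divide δ JV
  repeatN J ⟨w0, fun _ => Classical.arbitrary _, fun _ => Classical.arbitrary _⟩ fun s =>
    sApxVal I s.w w0 x ε δ'

/-- `SHighPrecisionRandVI(ε, δ, λ, W, Γ, ‖ψ⁻¹‖, ‖ψ‖)`. The loop carries the current iterate and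
the current error bound `W / 2 ^ k`. -/
noncomputable def sHighPrecisionRandVI (I : StructuredInput V A B)
    (ε δ lam W Γ normψinv normψ : V) :
    Prog V (Triple A B) (Option S) (Iterate V A B) := do
  let zero ← lit 0
  let one ← lit 1
  let two ← lit 2
  let four ← lit 4
  let a ← times normψ W
  let b ← divide a ε
  let lb ← logarithm b
  let l2 ← logarithm two
  let k ← divide lb l2
  let K ← ceiling k
  let gap ← minus one lam
  let l4 ← logarithm four
  let j ← divide l4 gap
  let J ← ceiling j
  let KV ← lit K
  let δ' ← divide δ KV
  let d ← times four normψinv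
  let d' ← times d Γ
  let factor ← divide gap d'
  let w0 ← tabulateNum fun _ => pure zero
  let res ← repeatN K
    ((⟨w0, fun _ => Classical.arbitrary _, fun _ => Classical.arbitrary _⟩, W) :
      Iterate V A B × V) fun s => do
    let εk ← divide s.2 two
    let acc ← times factor εk
    let s' ← sRandVI I s.1.w J acc δ'
    pure (s', εk)
  pure res.1

end Algorithms

/-! ### The hitting time problem -/

instance instNonemptyPair {α : Type} {β : α → Type} [h : Nonempty α] [h' : ∀ a, Nonempty (β a)] :
    Nonempty (Σ a, β a) :=
  h.elim fun a => (h' a).elim fun b => ⟨⟨a, b⟩⟩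

/-- The states other than `c`. -/
abbrev OtherState {S : Type} (c : S) : Type := {i : S // i ≠ c}

/-- In the reduced problem on `S \ {c}` MIN has one action and MAX chooses the pair `(a, b)`. -/
abbrev RedMin {S : Type} (c : S) (_ : OtherState c) : Type := Unit

abbrev RedMax {S : Type} (A : S → Type) (B : ∀ i, A i → Type) (c : S) (i : OtherState c)
    (_ : RedMin c i) : Type := Σ a : A i.1, B i.1 a

abbrev RedTriple {S : Type} (A : S → Type) (B : ∀ i, A i → Type) (c : S) : Type :=
  Triple (RedMin c) (RedMax A B c)

/-- The transition table with row and column `c` removed. -/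
def reducedTable {S : Type} {A : S → Type} {B : ∀ i, A i → Type} {V : Type}
    (P : Triple A B → S → V) (c : S) (e : RedTriple A B c)
    (j : OtherState c) : V :=
  P ⟨e.1.1, e.2.2⟩ j.1

theorem MeanPayoffGame.reduced_sum_le {S : Type} [Fintype S] [DecidableEq S]
    {A : S → Type} {B : ∀ i, A i → Type} (g : MeanPayoffGame S A B) (c : S)
    (e : RedTriple A B c) : ∑ j, reducedTable g.P c e j ≤ 1 := by
  rw [← g.P_sum ⟨e.1.1, e.2.2⟩]
  have h := Finset.sum_subtype (F := inferInstance) (p := fun j => j ≠ c)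
    (Finset.univ.filter fun j => j ≠ c)
    (by simp) (fun j => g.P ⟨e.1.1, e.2.2⟩ j)
  have h' : ∑ j, reducedTable g.P c e j =
      ∑ j ∈ Finset.univ.filter (fun j => j ≠ c), g.P ⟨e.1.1, e.2.2⟩ j := by
    rw [h]
    rfl
  rw [h']
  exact Finset.sum_le_sum_of_subset_of_nonneg (Finset.subset_univ _)
    fun j _ _ => g.P_nonneg _ j

section Hitting

variable {S : Type} [Fintype S] [DecidableEq S]
  {A : S → Type} [∀ i, Fintype (A i)] [∀ i, DecidableEq (A i)] [∀ i, Nonempty (A i)]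
  {B : ∀ i, A i → Type} [∀ i a, Fintype (B i a)] [∀ i a, DecidableEq (B i a)]
  [∀ i a, Nonempty (B i a)] {V : Type}

/-- The transition matrix of a pair of policies. -/
def MeanPayoffGame.transition (g : MeanPayoffGame S A B) (σ : MinPolicy A) (τ : MaxPolicy A B) :
    Matrix S S ℝ :=
  Matrix.of fun i j => g.P ⟨i, σ i, τ ⟨i, σ i⟩⟩ j

/-- Replace column `c` of a matrix by zeros. -/
def deflate (M : Matrix S S ℝ) (c : S) : Matrix S S ℝ := M.updateCol c 0

/-- `φ = e + max_{σ, τ} P^{σ τ}_(c) φ`, the equation of the maximal expected hitting times of `c`. -/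
def MeanPayoffGame.IsHittingVector (g : MeanPayoffGame S A B) (c : S) (φ : S → ℝ) : Prop :=
  ∀ i, φ i = 1 + ⨆ π : MinPolicy A × MaxPolicy A B,
    (deflate (g.transition π.1 π.2) c).mulVec φ i

/-- `φ i ≥ 1 + max_{a, b} P^{a b}_(c)i φ` for all `i`. -/
def MeanPayoffGame.IsScaling (g : MeanPayoffGame S A B) (c : S) (φ : S → ℝ) : Prop :=
  ∀ i, 1 + (⨆ ab : (Σ a : A i, B i a), Function.update (g.P ⟨i, ab⟩) c 0 ⬝ᵥ φ) ≤ φ i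

/-- The sampling oracle of the reduced problem. -/
noncomputable def MeanPayoffGame.reducedLaw (g : MeanPayoffGame S A B) (c : S)
    (e : RedTriple A B c) : PMF (Option (OtherState c)) :=
  cemeteryLaw (reducedTable g.P c e) (fun _ => g.P_nonneg _ _) (g.reduced_sum_le c e)

open Prog

/-- The operator `w ↦ 1 + max_{a, b} P̃ w` on `S \ {c}` as a structured input: `γ = 1`, `L = id`,
`‖L‖ = 1`, `G = 1`. -/
def reducedInput (P : Triple A B → S → V) (c : S) (one : V) :
    StructuredInput V (RedMin c) (RedMax A B c) where
  P := reducedTable P c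
  γ := fun _ => one
  L := fun w => pure w
  normL := one
  G := fun _ _ => lit 1

/-- The whole computation of `φ`: call `SHighPrecisionRandVI(1/4, δ, λ, 1, 1, 1, 1/(1-λ))` on the
reduced problem, with `λ = 1 - 1/H`; compute the missing component
`φ' c = 1 + max_{a, b} ∑_{j ≠ c} P j * w j`; return `φ = 2 φ'`. -/
noncomputable def computeScaling (P : Triple A B → S → V) (c : S) (H δ : V) :
    Prog V (RedTriple A B c) (Option (OtherState c)) (S → V) := do
  let one ← lit 1
  let two ← lit 2
  let four ← lit 4
  let ε ← divide one four
  let h ← divide one H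
  let lam ← minus one h
  let gap ← minus one lam
  let normψ ← divide one gap
  let it ← sHighPrecisionRandVI (reducedInput P c one) ε δ lam one one one normψ
  let q ← tabulateNum fun ab : (Σ a : A c, B c a) =>
    dot (fun j : OtherState c => P ⟨c, ab⟩ j.1) it.w
  let best ← argMax q
  let m ← read q best
  let φc ← plus one m
  tabulateNum fun i =>
    if hi : i = c then times two φc else do
      let wi ← read it.w ⟨i, hi⟩
      times two wi

/-- The joint law of the computed vector `φ` and of the running time. -/
noncomputable def MeanPayoffGame.scalingLaw (g : MeanPayoffGame S A B) (c : S) (H δ : ℝ) :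
    PMF ((S → ℝ) × ℕ) :=
  (computeScaling g.P c H δ).run (g.reducedLaw c)

end Hitting

/-- `1 - 1 / h`. -/
noncomputable def rateOf (h : ℝ) : ℝ := 1 - 1 / h

open scoped ENNReal

namespace Prog

/-- The expectation of `f` (output) (running time). -/
noncomputable def expect {Q R α : Type} (law : Q → PMF R) : Prog ℝ Q R α → (α → ℕ → ℝ≥0∞) → ℝ≥0∞
  | ret a, f => f a 0
  | tick k, f => expect law k fun a t => f a (t + 1)
  | load n k, f => expect law (k (n : ℝ)) fun a t => f a (t + 1)
  | arith o x y k, f => expect law (k (o.eval x y)) fun a t => f a (t + 1)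
  | ln x k, f => expect law (k (Real.log x)) fun a t => f a (t + 1)
  | less x y k, f => expect law (k (@decide (x < y) (Classical.dec _))) fun a t => f a (t + 1)
  | roundUp x k, f => expect law (k ⌈x⌉₊) fun a t => f a (t + 1)
  | query q k, f => ∑' r, law q r * expect law (k r) fun a t => f a (t + 1)

section Expect

variable {Q R α β : Type} (law : Q → PMF R)

theorem run_toOuterMeasure (p : Prog ℝ Q R α) (s : Set (α × ℕ)) :
    (p.run law).toOuterMeasure s = p.expect law fun a t => s.indicator 1 (a, t) := by
  induction p generalizing s with
  | ret a => simp [run, expect, PMF.toOuterMeasure_pure_apply, Set.indicator]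
  | query q k ih =>
    simp only [run, expect, PMF.toOuterMeasure_bind_apply, PMF.toOuterMeasure_map_apply, ih]
    rfl
  | _ =>
    rename_i ih
    simp only [run, expect, PMF.toOuterMeasure_map_apply, ih]
    rfl

theorem expect_mono (p : Prog ℝ Q R α) {f g : α → ℕ → ℝ≥0∞} (h : ∀ a t, f a t ≤ g a t) :
    p.expect law f ≤ p.expect law g := by
  induction p generalizing f g with
  | ret a => exact h _ _
  | query q k ih =>
    exact ENNReal.tsum_le_tsum fun r => mul_le_mul_right (ih r fun a t => h _ _) _
  | tick k ih => exact ih fun a t => h _ _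
  | _ => rename_i ih; exact ih _ fun a t => h _ _

theorem expect_add_const (p : Prog ℝ Q R α) (f : α → ℕ → ℝ≥0∞) (x : ℝ≥0∞) :
    (p.expect law fun a t => f a t + x) = p.expect law f + x := by
  induction p generalizing f with
  | ret a => rfl
  | query q k ih =>
    simp only [expect, ih, mul_add, ENNReal.tsum_add, ENNReal.tsum_mul_right, PMF.tsum_coe, one_mul]
  | tick k ih => exact ih _
  | _ => rename_i ih; exact ih _ _

theorem expect_mul_const (p : Prog ℝ Q R α) (f : α → ℕ → ℝ≥0∞) (x : ℝ≥0∞) :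
    (p.expect law fun a t => f a t * x) = p.expect law f * x := by
  induction p generalizing f with
  | ret a => rfl
  | query q k ih =>
    simp only [expect, ih, ← mul_assoc, ENNReal.tsum_mul_right]
  | tick k ih => exact ih _
  | _ => rename_i ih; exact ih _ _

theorem expect_const (p : Prog ℝ Q R α) (x : ℝ≥0∞) : (p.expect law fun _ _ => x) = x := by
  have h0 : (p.expect law fun _ _ => (0 : ℝ≥0∞)) = 0 := by
    simpa using expect_mul_const law p (fun _ _ => (0 : ℝ≥0∞)) 0
  simpa [h0] using expect_add_const law p (fun _ _ => (0 : ℝ≥0∞)) x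

theorem expect_add (p : Prog ℝ Q R α) (f g : α → ℕ → ℝ≥0∞) :
    (p.expect law fun a t => f a t + g a t) = p.expect law f + p.expect law g := by
  induction p generalizing f g with
  | ret a => rfl
  | query q k ih => simp only [expect, ih, mul_add, ENNReal.tsum_add]
  | tick k ih => exact ih _ _
  | _ => rename_i ih; exact ih _ _ _

theorem expect_bind (p : Prog ℝ Q R α) (k : α → Prog ℝ Q R β) (f : β → ℕ → ℝ≥0∞) :
    (p.bind k).expect law f = p.expect law fun a t => (k a).expect law fun b t' => f b (t + t') := by
  induction p generalizing f with
  | ret a => simp [bind, expect]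
  | query q k ih =>
    simp only [bind, expect, ih, add_assoc, add_comm 1]
  | tick k ih =>
    simp only [bind, expect, ih, add_assoc, add_comm 1]
  | _ =>
    rename_i ih
    simp only [bind, expect, ih, add_assoc, add_comm 1]

end Expect

/-- With probability at least `1 - η` the program `p` stops after at most `T` instructions with an
output that satisfies `post`. -/
def Ensures {Q R α : Type} (law : Q → PMF R) (p : Prog ℝ Q R α) (T : ℕ) (η : ℝ≥0∞)
    (post : α → Prop) : Prop :=
  (p.expect law fun a t => {z : α × ℕ | ¬ (post z.1 ∧ z.2 ≤ T)}.indicator 1 (a, t)) ≤ η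

namespace Ensures

variable {Q R α β ι σ : Type} {law : Q → PMF R} {T T' T₁ T₂ : ℕ} {η η' η₁ η₂ : ℝ≥0∞}
  {post post' : α → Prop} {post₂ : β → Prop} {p : Prog ℝ Q R α}

theorem mono (h : Ensures law p T η post) (hT : T ≤ T') (hη : η ≤ η')
    (hp : ∀ a, post a → post' a) : Ensures law p T' η' post' := by
  refine ((expect_mono law p fun a t => ?_).trans h).trans hη
  refine Set.indicator_le_indicator_of_subset ?_ (fun _ => zero_le) _
  rintro z hz ⟨h1, h2⟩
  exact hz ⟨hp _ h1, h2.trans hT⟩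

theorem mono_time (h : Ensures law p T η post) (hT : T ≤ T') : Ensures law p T' η post :=
  h.mono hT le_rfl fun _ => id

theorem pure_bind {a : β} {k : β → Prog ℝ Q R α} (h : Ensures law (k a) T η post) :
    Ensures law (Pure.pure a >>= k) T η post := h

theorem ret {a : α} (h : post a) : Ensures law (Prog.ret a) T η post := by
  simp [Ensures, expect, h]

theorem pure {a : α} (h : post a) : Ensures law (Pure.pure a) T η post := ret h

theorem of_shift {f : Prog ℝ Q R α}
    (h : Ensures law f T η post)
    (hp : p.expect law = fun g => f.expect law fun a t => g a (t + 1)) :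
    Ensures law p (T + 1) η post := by
  unfold Ensures
  rw [hp]
  refine le_trans (le_of_eq ?_) h
  congr! 3 with a t
  by_cases ha : post a <;> simp [Set.indicator, ha]

theorem tick (h : Ensures law p T η post) : Ensures law (Prog.tick p) (T + 1) η post :=
  h.of_shift rfl

theorem bind {k : α → Prog ℝ Q R β} (h : Ensures law p T₁ η₁ post)
    (hk : ∀ a, post a → Ensures law (k a) T₂ η₂ post₂) :
    Ensures law (p >>= k) (T₁ + T₂) (η₁ + η₂) post₂ := by
  change (p.bind k).expect law _ ≤ _
  rw [expect_bind]
  calc _ ≤ p.expect law (fun a t =>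
          {z : α × ℕ | ¬ (post z.1 ∧ z.2 ≤ T₁)}.indicator 1 (a, t) + η₂) := by
        refine expect_mono law p fun a t => ?_
        by_cases hz : post a ∧ t ≤ T₁
        · refine le_trans ?_ (le_add_left (hk a hz.1))
          refine expect_mono law _ fun b t' => ?_
          refine Set.indicator_le_indicator_of_subset (s := {u : β × ℕ | ¬ (post₂ u.1 ∧ t + u.2 ≤ T₁ + T₂)})
            (f := (1 : β × ℕ → ℝ≥0∞)) ?_ (fun _ => zero_le) (b, t')
          rintro u hu ⟨h1, h2⟩
          exact hu ⟨h1, add_le_add hz.2 h2⟩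
        · rw [Set.indicator_of_mem (by exact hz)]
          refine le_add_right ?_
          refine le_trans (expect_mono law _ fun b t' => ?_) (expect_const law (k a) 1).le
          exact Set.indicator_le_self' (fun _ _ => zero_le) _
    _ = _ := expect_add_const ..
    _ ≤ η₁ + η₂ := by gcongr; exact h

/-- Sequencing after a program that cannot fail. -/
theorem bind_sure {k : α → Prog ℝ Q R β} (h : Ensures law p T₁ 0 post)
    (hk : ∀ a, post a → Ensures law (k a) T₂ η post₂) :
    Ensures law (p >>= k) (T₁ + T₂) η post₂ := by
  simpa using h.bind hk

theorem le_toOuterMeasure {δ : ℝ} (hδ : 0 ≤ δ) (h : Ensures law p T (ENNReal.ofReal δ) post)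
    {s : Set (α × ℕ)} (hs : ∀ a t, post a → t ≤ T → (a, t) ∈ s) :
    ENNReal.ofReal (1 - δ) ≤ (p.run law).toOuterMeasure s := by
  rw [ENNReal.ofReal_sub _ hδ, ENNReal.ofReal_one, tsub_le_iff_right, run_toOuterMeasure]
  refine le_trans ?_ (add_le_add le_rfl h)
  rw [← expect_add, ← expect_const law p 1]
  refine expect_mono law p fun a t => ?_
  by_cases hz : post a ∧ t ≤ T
  · simp [hs a t hz.1 hz.2]
  · refine le_add_left ?_
    rw [Set.indicator_of_mem (by exact hz)]
    rfl

section Instructions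

theorem sample_bind {q : Q} {k : R → Prog ℝ Q R α} (h : ∀ r, Ensures law (k r) T η post) :
    Ensures law (sample q >>= k) (T + 1) η post := by
  change ∑' r, law q r * _ ≤ η
  refine (ENNReal.tsum_le_tsum fun r => mul_le_mul_right
    ((h r).of_shift (p := Prog.tick (k r)) rfl) _).trans ?_
  rw [ENNReal.tsum_mul_right, PMF.tsum_coe, one_mul]

theorem lit_bind {n : ℕ} {k : ℝ → Prog ℝ Q R α} (h : Ensures law (k n) T η post) :
    Ensures law (lit n >>= k) (T + 1) η post := h.of_shift rfl

theorem plus_bind {x y : ℝ} {k : ℝ → Prog ℝ Q R α} (h : Ensures law (k (x + y)) T η post) :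
    Ensures law (Prog.plus x y >>= k) (T + 1) η post := h.of_shift rfl

theorem minus_bind {x y : ℝ} {k : ℝ → Prog ℝ Q R α} (h : Ensures law (k (x - y)) T η post) :
    Ensures law (Prog.minus x y >>= k) (T + 1) η post := h.of_shift rfl

theorem times_bind {x y : ℝ} {k : ℝ → Prog ℝ Q R α} (h : Ensures law (k (x * y)) T η post) :
    Ensures law (Prog.times x y >>= k) (T + 1) η post := h.of_shift rfl

theorem divide_bind {x y : ℝ} {k : ℝ → Prog ℝ Q R α} (h : Ensures law (k (x / y)) T η post) :
    Ensures law (Prog.divide x y >>= k) (T + 1) η post := h.of_shift rfl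

theorem logarithm_bind {x : ℝ} {k : ℝ → Prog ℝ Q R α} (h : Ensures law (k (Real.log x)) T η post) :
    Ensures law (Prog.logarithm x >>= k) (T + 1) η post := h.of_shift rfl

theorem ceiling_bind {x : ℝ} {k : ℕ → Prog ℝ Q R α} (h : Ensures law (k ⌈x⌉₊) T η post) :
    Ensures law (Prog.ceiling x >>= k) (T + 1) η post := h.of_shift rfl

theorem isLess_bind {x y : ℝ} {k : Bool → Prog ℝ Q R α}
    (h₁ : x < y → Ensures law (k true) T η post)
    (h₂ : y ≤ x → Ensures law (k false) T η post) :
    Ensures law (Prog.isLess x y >>= k) (T + 1) η post := by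
  have h : Ensures law (k (@decide (x < y) (Classical.dec _))) T η post := by
    by_cases hxy : x < y
    · simpa [hxy] using h₁ hxy
    · simpa [hxy] using h₂ (not_lt.mp hxy)
  exact h.of_shift rfl

theorem read_bind {f : ι → ℝ} {i : ι} {k : ℝ → Prog ℝ Q R α} (h : Ensures law (k (f i)) T η post) :
    Ensures law (Prog.read f i >>= k) (T + 1) η post := h.of_shift rfl

theorem plus {x y : ℝ} {post : ℝ → Prop} (h : post (x + y)) :
    Ensures law (Prog.plus x y) (T + 1) η post := plus_bind (k := Prog.ret) (ret h)

theorem minus {x y : ℝ} {post : ℝ → Prop} (h : post (x - y)) :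
    Ensures law (Prog.minus x y) (T + 1) η post := minus_bind (k := Prog.ret) (ret h)

theorem times {x y : ℝ} {post : ℝ → Prop} (h : post (x * y)) :
    Ensures law (Prog.times x y) (T + 1) η post := times_bind (k := Prog.ret) (ret h)

theorem divide {x y : ℝ} {post : ℝ → Prop} (h : post (x / y)) :
    Ensures law (Prog.divide x y) (T + 1) η post := divide_bind (k := Prog.ret) (ret h)

theorem read {f : ι → ℝ} {i : ι} {post : ℝ → Prop} (h : post (f i)) :
    Ensures law (Prog.read f i) (T + 1) η post := read_bind (k := Prog.ret) (ret h)

end Instructions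

section Loops

theorem forEach {time : ι → ℕ} {risk : ι → ℝ≥0∞} {body : σ → ι → Prog ℝ Q R σ}
    (inv : List ι → σ → Prop)
    (hbody : ∀ i l s, inv (i :: l) s → Ensures law (body s i) (time i) (risk i) (inv l))
    (l : List ι) (s : σ) (hs : inv l s) :
    Ensures law (Prog.forEach l s body) ((l.map fun i => time i + 1).sum) ((l.map risk).sum)
      (inv []) := by
  induction l generalizing s with
  | nil => exact ret hs
  | cons i l ih =>
    refine (((hbody i l s hs).bind fun s' hs' => ih s' hs').tick).mono ?_ ?_ fun _ => id
    · simp only [List.map_cons, List.sum_cons]; omega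
    · simp

theorem repeatN {body : σ → Prog ℝ Q R σ} (inv : ℕ → σ → Prop) (m : ℕ)
    (hbody : ∀ j s, j < m → inv j s → Ensures law (body s) T η (inv (j + 1)))
    (s : σ) (hs : inv 0 s) :
    Ensures law (Prog.repeatN m s body) (m * (T + 1)) (m * η) (inv m) := by
  induction m generalizing s inv with
  | zero => exact ret hs
  | succ m ih =>
    refine (((hbody 0 s (by omega) hs).bind fun s' hs' =>
      ih (fun j => inv (j + 1)) (fun j t hj => hbody (j + 1) t (by omega)) s' hs').tick).mono
        ?_ ?_ fun _ => id
    · exact le_of_eq (by ring)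
    · exact le_of_eq (by push_cast; ring)

variable [Fintype ι]

theorem argMax [Nonempty ι] (q : ι → ℝ) :
    Ensures law (Prog.argMax q) (Fintype.card ι * 4) 0 fun b => ∀ i, q i ≤ q b := by
  have := forEach (law := law) (time := fun _ => 3) (risk := fun _ => 0)
    (body := fun (best : ι) i => do
      let x ← Prog.read q best
      let y ← Prog.read q i
      let t ← isLess x y
      if t then Pure.pure i else Pure.pure best)
    (fun l b => ∀ i, i ∉ l → q i ≤ q b) (by
      intro i l b hb
      have aux : ∀ j, j ∉ l → j = i ∨ q j ≤ q b := fun j hj => by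
        by_cases hji : j = i
        · exact Or.inl hji
        · exact Or.inr (hb j (by simp [hji, hj]))
      refine read_bind (read_bind (isLess_bind (T := 0) (fun h => pure ?_) fun h => pure ?_))
      · intro j hj
        rcases aux j hj with rfl | h'
        · exact le_rfl
        · exact h'.trans h.le
      · intro j hj
        rcases aux j hj with rfl | h'
        · exact h
        · exact h') Finset.univ.toList (Classical.arbitrary ι) (by simp)
  refine this.mono ?_ ?_ fun arr harr i => harr i (by simp)
  · rw [Finset.sum_map_toList]; simp
  · rw [Finset.sum_map_toList]; simp

theorem argMin [Nonempty ι] (q : ι → ℝ) :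
    Ensures law (Prog.argMin q) (Fintype.card ι * 4) 0 fun b => ∀ i, q b ≤ q i := by
  have := forEach (law := law) (time := fun _ => 3) (risk := fun _ => 0)
    (body := fun (best : ι) i => do
      let x ← Prog.read q best
      let y ← Prog.read q i
      let t ← isLess y x
      if t then Pure.pure i else Pure.pure best)
    (fun l b => ∀ i, i ∉ l → q b ≤ q i) (by
      intro i l b hb
      have aux : ∀ j, j ∉ l → j = i ∨ q b ≤ q j := fun j hj => by
        by_cases hji : j = i
        · exact Or.inl hji
        · exact Or.inr (hb j (by simp [hji, hj]))
      refine read_bind (read_bind (isLess_bind (T := 0) (fun h => pure ?_) fun h => pure ?_))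
      · intro j hj
        rcases aux j hj with rfl | h'
        · exact le_rfl
        · exact h.le.trans h'
      · intro j hj
        rcases aux j hj with rfl | h'
        · exact h
        · exact h') Finset.univ.toList (Classical.arbitrary ι) (by simp)
  refine this.mono ?_ ?_ fun arr harr i => harr i (by simp)
  · rw [Finset.sum_map_toList]; simp
  · rw [Finset.sum_map_toList]; simp

theorem dot (p z : ι → ℝ) :
    Ensures law (Prog.dot p z) (Fintype.card ι * 5 + 1) 0 fun s => s = ∑ j, p j * z j := by
  have := forEach (law := law) (time := fun _ => 4) (risk := fun _ => 0)
    (body := fun (s : ℝ) (j : ι) => do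
      let x ← Prog.read p j
      let y ← Prog.read z j
      let t ← Prog.times x y
      Prog.plus s t)
    (fun l s => s + (l.map fun j => p j * z j).sum = ∑ j, p j * z j) (by
      intro i l s hs
      refine read_bind (read_bind (times_bind (plus (T := 0) ?_)))
      rw [← hs, List.map_cons, List.sum_cons, add_assoc]) Finset.univ.toList ((0 : ℕ) : ℝ)
      (by rw [Finset.sum_map_toList]; simp)
  refine (lit_bind this).mono ?_ ?_ fun s hs => by simpa using hs
  · rw [Finset.sum_map_toList]; simp
  · rw [Finset.sum_map_toList]; simp

theorem supNorm (z : ι → ℝ) :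
    Ensures law (Prog.supNorm z) (Fintype.card ι * 5 + 1) 0 fun s => s = ‖z‖ := by
  have := forEach (law := law) (time := fun _ => 4) (risk := fun _ => 0)
    (body := fun (s : ℝ) (j : ι) => do
      let x ← Prog.read z j
      let neg ← isLess x ((0 : ℕ) : ℝ)
      let y ← if neg then Prog.minus ((0 : ℕ) : ℝ) x else Pure.pure x
      let t ← isLess s y
      if t then Pure.pure y else Pure.pure s)
    (fun l s => (0 ≤ s ∧ s ≤ ‖z‖) ∧ ∀ i, i ∉ l → |z i| ≤ s) (by
      rintro i l s ⟨⟨hs0, hs1⟩, hs⟩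
      have aux : ∀ j, j ∉ l → j = i ∨ |z j| ≤ s := fun j hj => by
        by_cases hji : j = i
        · exact Or.inl hji
        · exact Or.inr (hs j (by simp [hji, hj]))
      have key : Ensures law ((isLess s |z i| : Prog ℝ Q R Bool) >>= fun t =>
          if t then Pure.pure |z i| else Pure.pure s) 1 0
          (fun s => (0 ≤ s ∧ s ≤ ‖z‖) ∧ ∀ i, i ∉ l → |z i| ≤ s) := by
        refine isLess_bind (T := 0) (fun h => pure ⟨⟨abs_nonneg _, norm_le_pi_norm z i⟩, ?_⟩)
          fun h => pure ⟨⟨hs0, hs1⟩, ?_⟩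
        · intro j hj
          rcases aux j hj with rfl | h'
          · exact le_rfl
          · exact h'.trans h.le
        · intro j hj
          rcases aux j hj with rfl | h'
          · exact h
          · exact h'
      refine read_bind (isLess_bind (fun h => ?_) fun h => ?_)
      · refine minus_bind (T := 1) ?_
        rw [Nat.cast_zero] at h
        simpa [abs_of_neg h] using key
      · rw [Nat.cast_zero] at h
        rw [abs_of_nonneg h] at key
        exact key.mono_time (by norm_num)) Finset.univ.toList ((0 : ℕ) : ℝ)
      (by simp)
  refine (lit_bind this).mono ?_ ?_ fun s hs => ?_
  · rw [Finset.sum_map_toList]; simp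
  · rw [Finset.sum_map_toList]; simp
  · exact le_antisymm hs.1.2 ((pi_norm_le_iff_of_nonneg hs.1.1).2 fun i => hs.2 i (by simp))

variable [DecidableEq ι]

theorem tabulate {γ : ι → Type} {blank : ∀ i, γ i} {entry : ∀ i, Prog ℝ Q R (γ i)}
    {time : ι → ℕ} {risk : ι → ℝ≥0∞} {post : ∀ i, γ i → Prop}
    (h : ∀ i, Ensures law (entry i) (time i) (risk i) (post i)) :
    Ensures law (Prog.tabulate blank entry) (∑ i, (time i + 2)) (∑ i, risk i)
      fun arr => ∀ i, post i (arr i) := by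
  have := forEach (law := law) (time := fun i => time i + 1) (risk := risk)
    (body := fun arr i => do
      let v ← entry i
      write arr i v)
    (fun l arr => ∀ i, i ∉ l → post i (arr i)) (by
      intro i l arr harr
      refine ((h i).bind (T₂ := 1) (η₂ := 0) fun v hv => ?_).mono le_rfl (by simp) fun _ => id
      refine tick (T := 0) (ret fun j hj => ?_)
      by_cases hji : j = i
      · subst hji; simpa using hv
      · rw [Function.update_of_ne hji]
        exact harr j (by simp [hji, hj])) Finset.univ.toList blank (by simp)
  refine this.mono ?_ ?_ fun arr harr i => harr i (by simp)
  · rw [Finset.sum_map_toList]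
  · rw [Finset.sum_map_toList]

theorem tabulateNum {entry : ι → Prog ℝ Q R ℝ} {time : ι → ℕ} {risk : ι → ℝ≥0∞}
    {post : ι → ℝ → Prop}
    (h : ∀ i, Ensures law (entry i) (time i) (risk i) (post i)) :
    Ensures law (Prog.tabulateNum entry) (∑ i, (time i + 2) + 1) (∑ i, risk i)
      fun arr => ∀ i, post i (arr i) := lit_bind (tabulate h)

theorem tabulateNum_const {entry : ι → Prog ℝ Q R ℝ} {post : ι → ℝ → Prop}
    (h : ∀ i, Ensures law (entry i) T η (post i)) :
    Ensures law (Prog.tabulateNum entry) (Fintype.card ι * (T + 2) + 1) (Fintype.card ι * η)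
      fun arr => ∀ i, post i (arr i) := by
  simpa using tabulateNum h

end Loops

end Ensures

end Prog

/-- Hoeffding's lemma for a probability mass function on a finite type. -/
theorem PMF.sum_mul_exp_le {Ω : Type} [Fintype Ω] (q : PMF Ω) (X : Ω → ℝ) {M : ℝ}
    (hX : ∀ o, |X o| ≤ M) (t : ℝ) :
    ∑ o, (q o).toReal * Real.exp (t * X o) ≤
      Real.exp (t * ∑ o, (q o).toReal * X o + M ^ 2 * t ^ 2 / 2) := by
  let _ : MeasurableSpace Ω := ⊤
  have : DiscreteMeasurableSpace Ω := ⟨fun _ => trivial⟩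
  have hM : 0 ≤ M := by
    obtain ⟨o, -⟩ := q.support_nonempty
    exact (abs_nonneg _).trans (hX o)
  have h := (ProbabilityTheory.hasSubgaussianMGF_of_mem_Icc (μ := q.toMeasure) (X := X)
    (a := -M) (b := M) (measurable_of_finite X).aemeasurable
    (Filter.Eventually.of_forall fun o => abs_le.mp (hX o))).mgf_le t
  unfold ProbabilityTheory.mgf at h
  simp only [PMF.integral_eq_sum, smul_eq_mul] at h
  have h2 : (((‖M - -M‖₊ / 2) ^ 2 : NNReal) : ℝ) = M ^ 2 := by
    simp only [NNReal.coe_pow, NNReal.coe_div, coe_nnnorm, Real.norm_eq_abs, NNReal.coe_ofNat,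
      div_pow, sq_abs]
    ring
  rw [h2] at h
  calc ∑ o, (q o).toReal * Real.exp (t * X o)
      = Real.exp (t * ∑ o, (q o).toReal * X o) *
          ∑ o, (q o).toReal * Real.exp (t * (X o - ∑ o, (q o).toReal * X o)) := by
        rw [Finset.mul_sum]
        refine Finset.sum_congr rfl fun o _ => ?_
        rw [mul_left_comm, ← Real.exp_add]
        congr 2
        ring
    _ ≤ _ := by
        rw [Real.exp_add]
        gcongr

namespace Prog

section Sampling

variable {Q R α : Type} {law : Q → PMF R}

/-- Markov's inequality. -/
theorem Ensures.of_expect {p : Prog ℝ Q R α} {T : ℕ} {η : ℝ≥0∞} {post : α → Prop}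
    (hT : Ensures law p T 0 fun _ => True) (f : α → ℝ≥0∞) (hf : ∀ a, ¬ post a → 1 ≤ f a)
    (hη : (p.expect law fun a _ => f a) ≤ η) : Ensures law p T η post := by
  refine (expect_mono law p (g := fun a t =>
    {z : α × ℕ | ¬ (True ∧ z.2 ≤ T)}.indicator 1 (a, t) + f a) fun a t => ?_).trans ?_
  · by_cases ha : post a
    · refine le_add_right ?_
      simp [Set.indicator, ha]
    · exact le_add_left ((Set.indicator_le_self' (fun _ _ => zero_le) _).trans (hf a ha))
  · rw [expect_add]
    exact (add_le_add hT hη).trans (by simp)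

theorem expect_repeatN_exp [Fintype R] (e : Q) (X : R → ℝ) {body : ℝ → Prog ℝ Q R ℝ}
    (hbody : ∀ s (f : ℝ → ℝ≥0∞),
      ((body s).expect law fun a _ => f a) = ∑ o, law e o * f (s + X o)) (t : ℝ) (m : ℕ) (s : ℝ) :
    ((repeatN m s body).expect law fun a _ => ENNReal.ofReal (Real.exp (t * a))) =
      ENNReal.ofReal (Real.exp (t * s)) *
        (∑ o, law e o * ENNReal.ofReal (Real.exp (t * X o))) ^ m := by
  induction m generalizing s with
  | zero => simp [repeatN, expect]
  | succ m ih =>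
    simp only [repeatN, expect, expect_bind, ih]
    rw [hbody s fun a => ENNReal.ofReal (Real.exp (t * a)) *
        (∑ o, law e o * ENNReal.ofReal (Real.exp (t * X o))) ^ m]
    simp only [mul_add, Real.exp_add, ENNReal.ofReal_mul (Real.exp_pos _).le]
    rw [pow_succ', ← mul_assoc, Finset.mul_sum, Finset.sum_mul]
    exact Finset.sum_congr rfl fun o _ => by ring

theorem expect_repeatN_exp_le [Fintype R] (e : Q) (X : R → ℝ) {body : ℝ → Prog ℝ Q R ℝ}
    (hbody : ∀ s (f : ℝ → ℝ≥0∞),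
      ((body s).expect law fun a _ => f a) = ∑ o, law e o * f (s + X o))
    {M : ℝ} (hX : ∀ o, |X o| ≤ M) (t : ℝ) (m : ℕ) :
    ((repeatN m 0 body).expect law fun a _ => ENNReal.ofReal (Real.exp (t * a))) ≤
      ENNReal.ofReal (Real.exp
        (m * (t * ∑ o, (law e o).toReal * X o + M ^ 2 * t ^ 2 / 2))) := by
  rw [expect_repeatN_exp e X hbody, mul_zero, Real.exp_zero, ENNReal.ofReal_one, one_mul,
    Real.exp_nat_mul, ENNReal.ofReal_pow (Real.exp_pos _).le]
  gcongr
  refine le_trans (le_of_eq ?_) (ENNReal.ofReal_le_ofReal ((law e).sum_mul_exp_le X hX t))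
  rw [ENNReal.ofReal_sum_of_nonneg fun o _ => by positivity]
  refine Finset.sum_congr rfl fun o _ => ?_
  rw [ENNReal.ofReal_mul ENNReal.toReal_nonneg, ENNReal.ofReal_toReal ((law e).apply_ne_top o)]

/-- Hoeffding's inequality for the sum of independent samples. -/
theorem Ensures.repeatN_hoeffding [Fintype R] (e : Q) (X : R → ℝ) {body : ℝ → Prog ℝ Q R ℝ}
    (hbody : ∀ s (f : ℝ → ℝ≥0∞),
      ((body s).expect law fun a _ => f a) = ∑ o, law e o * f (s + X o))
    {T : ℕ} (htime : ∀ s, Ensures law (body s) T 0 fun _ => True)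
    {M ε : ℝ} (hM : 0 < M) (hε : 0 ≤ ε) (hX : ∀ o, |X o| ≤ M) (m : ℕ) :
    Ensures law (Prog.repeatN m 0 body) (m * (T + 1))
      (ENNReal.ofReal (2 * Real.exp (-(m * (ε ^ 2 / (2 * M ^ 2))))))
      fun s => |s - m * ∑ o, (law e o).toReal * X o| ≤ m * ε := by
  set μ := ∑ o, (law e o).toReal * X o with hμ
  have ht : Ensures law (Prog.repeatN m 0 body) (m * (T + 1)) 0 fun _ => True := by
    simpa using Ensures.repeatN (law := law) (fun _ _ => True) m
      (fun _ s _ _ => htime s) (0 : ℝ) trivial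
  have key : ∀ r : ℝ, r ^ 2 = 1 →
      ((Prog.repeatN m 0 body).expect law fun a _ =>
        ENNReal.ofReal (Real.exp (r * (ε / M ^ 2) * a)) *
          ENNReal.ofReal (Real.exp (-(r * (ε / M ^ 2) * (m * μ)) - ε / M ^ 2 * (m * ε)))) ≤
        ENNReal.ofReal (Real.exp (-(m * (ε ^ 2 / (2 * M ^ 2))))) := by
    intro r hr
    rw [expect_mul_const]
    refine (mul_le_mul_left (expect_repeatN_exp_le e X hbody hX _ m) _).trans (le_of_eq ?_)
    rw [← ENNReal.ofReal_mul (Real.exp_pos _).le, ← Real.exp_add, mul_pow, hr]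
    congr 2
    field_simp
    ring
  refine Ensures.of_expect ht (fun a =>
    ENNReal.ofReal (Real.exp (1 * (ε / M ^ 2) * a)) *
          ENNReal.ofReal (Real.exp (-(1 * (ε / M ^ 2) * (m * μ)) - ε / M ^ 2 * (m * ε))) +
    ENNReal.ofReal (Real.exp (-1 * (ε / M ^ 2) * a)) *
          ENNReal.ofReal (Real.exp (-(-1 * (ε / M ^ 2) * (m * μ)) - ε / M ^ 2 * (m * ε))))
    (fun a ha => ?_) ?_
  · have hc : 0 ≤ ε / M ^ 2 := by positivity
    have one_le : ∀ x y : ℝ, 0 ≤ x + y →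
        1 ≤ ENNReal.ofReal (Real.exp x) * ENNReal.ofReal (Real.exp y) := fun x y hxy => by
      rw [← ENNReal.ofReal_mul (Real.exp_pos _).le, ← Real.exp_add, ENNReal.one_le_ofReal]
      exact Real.one_le_exp hxy
    rcases lt_abs.mp (not_le.mp ha) with h | h
    · refine le_add_right (one_le _ _ ?_)
      have := mul_nonneg hc (sub_nonneg.mpr h.le)
      linarith
    · refine le_add_left (one_le _ _ ?_)
      have := mul_nonneg hc (sub_nonneg.mpr h.le)
      linarith
  · rw [expect_add, two_mul, ENNReal.ofReal_add (Real.exp_pos _).le (Real.exp_pos _).le]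
    exact add_le_add (key 1 (by norm_num)) (key (-1) (by norm_num))

end Sampling

end Prog

section Estimate

variable {S : Type} [Fintype S] {A : S → Type} {B : ∀ i, A i → Type}
  {P : Triple A B → S → ℝ} {law : Triple A B → PMF (Option S)}

open Prog

theorem apxTransC_ensures (hP : ∀ e j, 0 ≤ P e j)
    (hlaw : ∀ e j, law e (some j) = ENNReal.ofReal (P e j)) (u : S → ℝ) {M ε δ : ℝ} (hM : 0 ≤ M)
    (hu : ∀ j, |u j| ≤ M) (hε : 0 < ε) (hδ : 0 < δ) (hδ' : δ < 2) (e : Triple A B) {N : ℕ}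
    (hN : 2 * (M * M) / (ε * ε) * Real.log (2 / δ) ≤ N) :
    Ensures law (apxTransC u M e ε δ) (N * 4 + 12) (ENNReal.ofReal δ)
      fun y => |y - ∑ j, P e j * u j| ≤ ε := by
  let X : Option S → ℝ := fun o => o.elim 0 u
  have hX : ∀ o, |X o| ≤ M := by
    rintro (_ | j)
    · simpa [X] using hM
    · exact hu j
  have hμ : ∑ o, (law e o).toReal * X o = ∑ j, P e j * u j := by
    simp [X, Fintype.sum_option, hlaw, hP]
  unfold apxTransC
  refine Ensures.lit_bind (Ensures.lit_bind (Ensures.times_bind (Ensures.times_bind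
    (Ensures.times_bind (Ensures.divide_bind (Ensures.divide_bind (Ensures.logarithm_bind
    (Ensures.times_bind (Ensures.ceiling_bind ?_)))))))))
  simp only [Nat.cast_zero, Nat.cast_ofNat]
  set v := 2 * (M * M) / (ε * ε) * Real.log (2 / δ) with hv
  have hm : ⌈v⌉₊ ≤ N := Nat.ceil_le.mpr hN
  have hbody : ∀ s (f : ℝ → ℝ≥0∞),
      ((sample e >>= fun o => match o with
        | none => pure s
        | some j => do
          let uj ← read u j
          plus s uj : Prog ℝ (Triple A B) (Option S) ℝ).expect law fun a _ => f a) =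
        ∑ o, law e o * f (s + X o) := by
    intro s f
    change ∑' o, _ = _
    rw [tsum_fintype]
    refine Finset.sum_congr rfl fun o _ => ?_
    cases o with
    | none => simp [X, expect, Prog.bind, pure]
    | some j => rfl
  have htime : ∀ s, Ensures law (sample e >>= fun o => match o with
        | none => pure s
        | some j => do
          let uj ← read u j
          plus s uj : Prog ℝ (Triple A B) (Option S) ℝ) 3 0 fun _ => True := by
    intro s
    refine Ensures.sample_bind fun o => ?_
    cases o with
    | none => exact Ensures.pure trivial
    | some j => exact Ensures.read_bind (Ensures.plus trivial)
  have hloop := fun hM => Ensures.repeatN_hoeffding e X hbody htime (M := M) hM hε.le hX ⌈v⌉₊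
  rcases hM.eq_or_lt with hM | hM
  · have hv0 : ⌈v⌉₊ = 0 := by simp [hv, ← hM]
    have hu0 : ∀ j, u j = 0 := fun j => abs_nonpos_iff.mp (hM ▸ hu j)
    rw [hv0]
    refine (Ensures.lit_bind (Ensures.divide (T := 0) ?_) : Ensures law _ 2 _ _).mono_time
      (by omega)
    simpa [hu0] using hε.le
  · have hl : 0 < Real.log (2 / δ) := Real.log_pos (by rw [lt_div_iff₀ hδ]; linarith)
    have hvpos : 0 < v := by positivity
    have hmpos : (0 : ℝ) < ⌈v⌉₊ := by exact_mod_cast Nat.ceil_pos.mpr hvpos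
    have hrisk : 2 * Real.exp (-(⌈v⌉₊ * (ε ^ 2 / (2 * M ^ 2)))) ≤ δ := by
      have h1 : Real.log (2 / δ) ≤ ⌈v⌉₊ * (ε ^ 2 / (2 * M ^ 2)) := by
        calc Real.log (2 / δ) = v * (ε ^ 2 / (2 * M ^ 2)) := by rw [hv]; field_simp
          _ ≤ _ := by gcongr; exact Nat.le_ceil v
      have h2 : Real.exp (-(⌈v⌉₊ * (ε ^ 2 / (2 * M ^ 2)))) ≤ δ / 2 := by
        calc _ ≤ Real.exp (-Real.log (2 / δ)) := by gcongr
          _ = δ / 2 := by rw [← Real.log_inv, Real.exp_log (by positivity), inv_div]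
      linarith
    have := (hloop hM).bind (k := fun total => lit ⌈v⌉₊ >>= fun mV => divide total mV) (η₂ := 0) (T₂ := 2)
      (post₂ := fun y => |y - ∑ j, P e j * u j| ≤ ε) fun total htot => Ensures.lit_bind (Ensures.divide ?_)
    · refine this.mono (by omega) ?_ fun _ => id
      rw [add_zero]
      exact ENNReal.ofReal_le_ofReal hrisk
    · rw [hμ] at htot
      have : total / ⌈v⌉₊ - ∑ j, P e j * u j = (total - ⌈v⌉₊ * ∑ j, P e j * u j) / ⌈v⌉₊ := by
        field_simp
      rw [this, abs_div, abs_of_pos hmpos, div_le_iff₀ hmpos]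
      linarith

end Estimate

theorem div_natCast_le {x : ℝ} (hx : 0 ≤ x) (n : ℕ) : x / n ≤ x := by
  rcases Nat.eq_zero_or_pos n with rfl | hn
  · simpa using hx
  · exact div_le_self hx (by exact_mod_cast hn)

theorem natCast_mul_ofReal_div_le {x : ℝ} (hx : 0 ≤ x) (n : ℕ) :
    n * ENNReal.ofReal (x / n) ≤ ENNReal.ofReal x := by
  rw [← ENNReal.ofReal_natCast, ← ENNReal.ofReal_mul n.cast_nonneg]
  refine ENNReal.ofReal_le_ofReal ?_
  rcases Nat.eq_zero_or_pos n with rfl | hn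
  · simpa using hx
  · have : (n : ℝ) ≠ 0 := by positivity
    exact (mul_div_cancel₀ x this).le

theorem Fintype.card_le_card_sigma {ι : Type} [Fintype ι] {κ : ι → Type} [∀ i, Fintype (κ i)]
    [∀ i, Nonempty (κ i)] : Fintype.card ι ≤ Fintype.card (Σ i, κ i) :=
  Fintype.card_le_of_injective (fun i => ⟨i, Classical.arbitrary _⟩) fun i j h => by
    simpa using congrArg Sigma.fst h

theorem log_two_div_nonneg {x : ℝ} (h0 : 0 ≤ x) (h2 : x ≤ 2) : 0 ≤ Real.log (2 / x) := by
  rcases h0.eq_or_lt with rfl | h0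
  · simp
  · exact Real.log_nonneg (by rwa [le_div_iff₀ h0, one_mul])

section ValueVector

variable {S : Type} [Fintype S] {A : S → Type} {B : ∀ i, A i → Type} {P : Triple A B → S → ℝ}

/-- `it` is a min-max evaluation of some `ε`-approximation of the table `P w + 1`. -/
def Iterate.Approximates (it : Iterate ℝ A B) (P : Triple A B → S → ℝ) (w : S → ℝ) (ε : ℝ) :
    Prop :=
  ∃ q : Triple A B → ℝ, (∀ e, |q e - (∑ j, P e j * w j + 1)| ≤ ε) ∧
    (∀ i a b, q ⟨i, a, b⟩ ≤ q ⟨i, a, it.τ ⟨i, a⟩⟩) ∧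
    (∀ i a, it.w i ≤ q ⟨i, a, it.τ ⟨i, a⟩⟩) ∧
    ∀ i, it.w i = q ⟨i, it.σ i, it.τ ⟨i, it.σ i⟩⟩

/-- The one-player equation `φ i = 1 + max P φ` with `1 ≤ φ ≤ H`. -/
structure IsValueVector (P : Triple A B → S → ℝ) (H : ℝ) (φ : S → ℝ) : Prop where
  one_le : ∀ i, 1 ≤ φ i
  le : ∀ i, φ i ≤ H
  one_add_le : ∀ e : Triple A B, 1 + ∑ j, P e j * φ j ≤ φ e.1
  attained : ∀ i, ∃ a b, φ i = 1 + ∑ j, P ⟨i, a, b⟩ j * φ j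

theorem IsValueVector.abs_sub_le [∀ i, Subsingleton (A i)] (hP : ∀ e j, 0 ≤ P e j) {H : ℝ}
    (hH : 0 < H) {φ : S → ℝ} (hφ : IsValueVector P H φ) {w : S → ℝ} {ε ρ : ℝ} (hε : 0 ≤ ε)
    (hρ : 0 ≤ ρ) (hw : ∀ i, |w i - φ i| ≤ ρ * φ i) {it : Iterate ℝ A B}
    (hit : it.Approximates P w ε) (i : S) :
    |it.w i - φ i| ≤ ((1 - 1 / H) * ρ + ε) * φ i := by
  obtain ⟨q, hq, hτ, hle, heq⟩ := hit
  have hs : ∀ e, |∑ j, P e j * w j - ∑ j, P e j * φ j| ≤ ρ * ((1 - 1 / H) * φ e.1) := by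
    intro e
    calc |∑ j, P e j * w j - ∑ j, P e j * φ j| = |∑ j, P e j * (w j - φ j)| := by
          simp only [mul_sub, Finset.sum_sub_distrib]
      _ ≤ ∑ j, |P e j * (w j - φ j)| := Finset.abs_sum_le_sum_abs _ _
      _ ≤ ∑ j, ρ * (P e j * φ j) := Finset.sum_le_sum fun j _ => by
          rw [abs_mul, abs_of_nonneg (hP e j), mul_left_comm]
          exact mul_le_mul_of_nonneg_left (hw j) (hP e j)
      _ = ρ * ∑ j, P e j * φ j := (Finset.mul_sum ..).symm
      _ ≤ ρ * ((1 - 1 / H) * φ e.1) := by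
          have h1 := hφ.one_add_le e
          have h2 : φ e.1 / H ≤ 1 := (div_le_one hH).mpr (hφ.le _)
          have h3 : (1 - 1 / H) * φ e.1 = φ e.1 - φ e.1 / H := by ring
          gcongr
          linarith
  have hεφ : ε ≤ ε * φ i := le_mul_of_one_le_right hε (hφ.one_le i)
  obtain ⟨a, b, hab⟩ := hφ.attained i
  have hσ : it.σ i = a := Subsingleton.elim _ _
  rw [abs_le]
  constructor
  · have h1 := hτ i a b
    have h2 := abs_le.mp (hq ⟨i, a, b⟩)
    have h3 := abs_le.mp (hs ⟨i, a, b⟩)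
    have h4 := heq i
    rw [hσ] at h4
    simp only at h3
    linarith
  · have h2 := abs_le.mp (hq ⟨i, it.σ i, it.τ ⟨i, it.σ i⟩⟩)
    have h3 := abs_le.mp (hs ⟨i, it.σ i, it.τ ⟨i, it.σ i⟩⟩)
    have h4 := heq i
    have h5 := hφ.one_add_le ⟨i, it.σ i, it.τ ⟨i, it.σ i⟩⟩
    simp only at h3 h5
    linarith

end ValueVector

section Iteration

open Prog

variable {S : Type} [Fintype S] [DecidableEq S]
  {A : S → Type} [∀ i, Fintype (A i)] [∀ i, DecidableEq (A i)] [∀ i, Nonempty (A i)]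
  {B : ∀ i, A i → Type} [∀ i a, Fintype (B i a)] [∀ i a, DecidableEq (B i a)]
  [∀ i a, Nonempty (B i a)]

/-- The structured input with `γ = 1`, `L = id` and `G = 1`. -/
def unitInput (P : Triple A B → S → ℝ) : StructuredInput ℝ A B where
  P := P
  γ := fun _ => 1
  L := fun w => pure w
  normL := 1
  G := fun _ _ => lit 1

variable {P : Triple A B → S → ℝ} {law : Triple A B → PMF (Option S)}

theorem sApxVal_ensures (hP : ∀ e j, 0 ≤ P e j)
    (hlaw : ∀ e j, law e (some j) = ENNReal.ofReal (P e j)) {w w0 : S → ℝ}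
    {x : Triple A B → ℝ} (hx : ∀ e, x e = ∑ j, P e j * w0 j) {ε δ : ℝ} (hε : 0 < ε) (hδ : 0 < δ)
    (hδ' : δ < 2) {N : ℕ}
    (hN : 2 * (‖w - w0‖ * ‖w - w0‖) / (ε * ε) *
      Real.log (2 / (δ / Fintype.card (Triple A B))) ≤ N) :
    Ensures law (sApxVal (unitInput P) w w0 x ε δ)
      (Fintype.card (Triple A B) * (4 * N + 48) + 8) (ENNReal.ofReal δ)
      fun it => it.Approximates P w ε := by
  have hcard : Fintype.card (Triple A B) =
      ∑ ia : (Σ i, A i), Fintype.card (B ia.1 ia.2) := by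
    rw [Fintype.card_sigma, Fintype.sum_sigma]
    simp_rw [Fintype.card_sigma]
  have h1 : Fintype.card (Σ i, A i) ≤ Fintype.card (Triple A B) := by
    rw [hcard, ← Fintype.card_sigma]
    exact Fintype.card_le_card_sigma (κ := fun ia : (Σ i, A i) => B ia.1 ia.2)
  have h2 : Fintype.card S ≤ Fintype.card (Σ i, A i) := Fintype.card_le_card_sigma
  unfold sApxVal
  refine Ensures.mono (T :=
    (Fintype.card S * 5 + 1) + ((Fintype.card S * 5 + 1) +
      ((Fintype.card (Triple A B) * (N * 4 + 12 + 5 + 1 + 2) + 1) +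
        ((∑ ia : (Σ i, A i), (Fintype.card (B ia.1 ia.2) * 4 + 2)) +
        ((Fintype.card (Σ i, A i) * 3 + 1) + ((∑ i, (Fintype.card (A i) * 4 + 2)) +
        ((Fintype.card S * 3 + 1) + 0)))) + 3))) (η := Fintype.card (Triple A B) *
    ENNReal.ofReal (δ / Fintype.card (Triple A B))) ?_ ?_
    (natCast_mul_ofReal_div_le hδ.le _) fun _ => id
  · refine Ensures.bind_sure (Ensures.mono (Ensures.tabulateNum_const (η := 0)
      (post := fun i v => v = (w - w0) i) fun i =>
      Ensures.read_bind (Ensures.read_bind (Ensures.minus (T := 0) rfl))) le_rfl (by simp)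
      fun _ => id) fun d hd => ?_
    obtain rfl : d = w - w0 := funext hd
    refine Ensures.bind_sure (Ensures.supNorm _) fun nd hnd => ?_
    subst hnd
    refine Ensures.times_bind (Ensures.pure_bind (Ensures.lit_bind (Ensures.divide_bind ?_)))
    refine (Ensures.bind (η₂ := 0) (Ensures.tabulateNum_const
      (post := fun e v => |v - (∑ j, P e j * w j + 1)| ≤ ε) fun e => ?_) fun q hq => ?_).mono
        le_rfl (add_zero _).le fun _ => id
    · refine Ensures.read_bind ?_
      have hpos : (0 : ℝ) < Fintype.card (Triple A B) := by
        exact_mod_cast Fintype.card_pos_iff.mpr ⟨e⟩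
      refine (Ensures.bind (T₂ := 5) (η₂ := 0) (apxTransC_ensures hP hlaw (w - w0) (N := N) (by
          change 0 ≤ 1 * ‖w - w0‖; positivity)
        (fun j => ?_) hε (by positivity)
        (lt_of_le_of_lt (div_natCast_le hδ.le _) hδ') e ?_) fun y hy => ?_).mono
          le_rfl (add_zero _).le fun _ => id
      · change _ ≤ 1 * ‖w - w0‖
        rw [one_mul]
        exact norm_le_pi_norm (w - w0) j
      · change 2 * (1 * ‖w - w0‖ * (1 * ‖w - w0‖)) / _ * _ ≤ _
        simpa only [one_mul] using hN
      · refine Ensures.plus_bind (Ensures.read_bind (Ensures.times_bind (Ensures.lit_bind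
          (Ensures.plus (T := 0) ?_))))
        have h3 : (unitInput P).γ e * (x e + y) + ((1 : ℕ) : ℝ) - (∑ j, P e j * w j + 1) =
            y - ∑ j, P e j * (w - w0) j := by
          simp only [unitInput, hx, Pi.sub_apply, mul_sub, Finset.sum_sub_distrib]
          push_cast
          ring
        rw [h3]
        exact hy
    · refine Ensures.bind_sure ((Ensures.tabulate (risk := fun _ => 0)
        fun ia => Ensures.argMax _).mono le_rfl (by simp) fun _ => id) fun τ hτ => ?_
      refine Ensures.bind_sure (Ensures.mono (Ensures.tabulateNum_const (η := 0)
        (post := fun ia v => v = q ⟨ia.1, ia.2, τ ia⟩) fun ia =>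
          Ensures.read (T := 0) rfl) le_rfl (by simp) fun _ => id) fun wa hwa => ?_
      refine Ensures.bind_sure ((Ensures.tabulate (risk := fun _ => 0)
        fun i => Ensures.argMin _).mono le_rfl (by simp) fun _ => id) fun σ hσ => ?_
      refine Ensures.bind_sure (Ensures.mono (Ensures.tabulateNum_const (η := 0)
        (post := fun i v => v = wa ⟨i, σ i⟩) fun i =>
          Ensures.read (T := 0) rfl) le_rfl (by simp) fun _ => id) fun w' hw' => ?_
      refine Ensures.pure (T := 0) ⟨q, hq, fun i a b => hτ ⟨i, a⟩ b, fun i a => ?_, fun i => ?_⟩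
      · change w' i ≤ _
        rw [hw', ← hwa ⟨i, a⟩]
        exact hσ i a
      · change w' i = _
        rw [hw', hwa]
  · simp only [Finset.sum_add_distrib, ← Finset.sum_mul, ← hcard, ← Fintype.card_sigma,
      Finset.sum_const, Finset.card_univ, smul_eq_mul]
    nlinarith

theorem sRandVI_ensures [∀ i, Subsingleton (A i)] (hP : ∀ e j, 0 ≤ P e j)
    (hlaw : ∀ e j, law e (some j) = ENNReal.ofReal (P e j)) {H : ℝ} (hH : 1 ≤ H) {φ : S → ℝ}
    (hφ : IsValueVector P H φ) {w0 : S → ℝ} {r : ℝ} (hr : 0 < r)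
    (hw0 : ∀ i, |w0 i - φ i| ≤ 2 * r * φ i) {J : ℕ} (hJ : (1 - 1 / H) ^ J ≤ 1 / 4)
    {δ : ℝ} (hδ : 0 < δ) (hδ' : δ < 2) {N : ℕ}
    (hN : 578 * H ^ 4 * Real.log (2 / (δ / J / Fintype.card (Triple A B))) ≤ N) :
    Ensures law (sRandVI (unitInput P) w0 J (r / (4 * H)) δ)
      (Fintype.card (Triple A B) * (5 * Fintype.card S + 3) + 3 +
        J * (Fintype.card (Triple A B) * (4 * N + 48) + 9)) (ENNReal.ofReal δ)
      fun it => ∀ i, |it.w i - φ i| ≤ r * φ i := by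
  have hH0 : 0 < H := by linarith
  have hlam0 : 0 ≤ 1 - 1 / H := by rw [sub_nonneg, div_le_one hH0]; exact hH
  have hlam1 : 1 - 1 / H ≤ 1 := by have := (one_div_pos.mpr hH0); linarith
  have hφ0 : ∀ i, 0 ≤ φ i := fun i => by linarith [hφ.one_le i]
  unfold sRandVI
  refine Ensures.mono (T :=
    (Fintype.card (Triple A B) * (Fintype.card S * 5 + 1 + 2) + 1) +
      (J * (Fintype.card (Triple A B) * (4 * N + 48) + 8 + 1) + 2)) (η := J * ENNReal.ofReal (δ / J)) ?_ ?_
    (natCast_mul_ofReal_div_le hδ.le _) fun _ => id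
  · refine Ensures.pure_bind (Ensures.bind_sure (Ensures.mono (Ensures.tabulateNum_const (η := 0)
      (post := fun e v => v = ∑ j, P e j * w0 j) fun e => Ensures.dot _ _)
      le_rfl (by simp) fun _ => id) fun x hx => ?_)
    refine Ensures.lit_bind (Ensures.divide_bind ?_)
    refine (Ensures.repeatN (fun k it => ∀ i, |it.w i - φ i| ≤
      ((1 - 1 / H) ^ k * (2 * r) + r / 4) * φ i) J (fun k it hk hit => ?_) _ ?_).mono le_rfl le_rfl
        fun it hit i => (hit i).trans ?_
    · have hJ0 : (0 : ℝ) < J := by exact_mod_cast (by omega : 0 < J)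
      have hpow : (1 - 1 / H) ^ k ≤ 1 := pow_le_one₀ hlam0 hlam1
      have hδJ := div_natCast_le hδ.le J
      refine (sApxVal_ensures hP hlaw hx (N := N) (by positivity) (by positivity)
        (hδJ.trans_lt hδ') ?_).mono le_rfl le_rfl fun it' hit' i => ?_
      · refine le_trans (mul_le_mul_of_nonneg_right ?_ (log_two_div_nonneg (by positivity) ?_)) hN
        · have hnorm : ‖it.w - w0‖ ≤ 17 / 4 * r * H := by
            refine (pi_norm_le_iff_of_nonneg (by positivity)).mpr fun i => ?_
            rw [Pi.sub_apply, Real.norm_eq_abs]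
            calc |it.w i - w0 i| ≤ |it.w i - φ i| + |w0 i - φ i| := by
                  rw [abs_sub_comm (w0 i)]; exact _root_.abs_sub_le _ _ _
              _ ≤ (1 * (2 * r) + r / 4) * φ i + 2 * r * φ i := by
                  refine add_le_add ((hit i).trans ?_) (hw0 i)
                  have := hφ0 i
                  gcongr
              _ = 17 / 4 * r * φ i := by ring
              _ ≤ 17 / 4 * r * H := by have := hφ.le i; gcongr
          calc _ ≤ 2 * (17 / 4 * r * H * (17 / 4 * r * H)) / (r / (4 * H) * (r / (4 * H))) := by
                gcongr
            _ = 578 * H ^ 4 := by field_simp; ring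
        · exact ((div_natCast_le (by positivity) _).trans hδJ).trans hδ'.le
      · refine (hφ.abs_sub_le hP hH0 (by positivity) (by positivity) hit hit' i).trans (le_of_eq ?_)
        have hq : r / (4 * H) = (1 - (1 - 1 / H)) * (r / 4) := by field_simp; ring
        rw [hq]
        ring
    · intro i
      refine (hw0 i).trans ?_
      have := hφ0 i
      rw [pow_zero, one_mul]
      gcongr
      linarith
    · have := hφ0 i
      gcongr
      nlinarith
  · exact le_of_eq (by ring)

theorem sHighPrecisionRandVI_ensures [∀ i, Subsingleton (A i)] (hP : ∀ e j, 0 ≤ P e j)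
    (hlaw : ∀ e j, law e (some j) = ENNReal.ofReal (P e j)) {H : ℝ} (hH : 1 ≤ H) {φ : S → ℝ}
    (hφ : IsValueVector P H φ) {ε : ℝ} (hε : 0 < ε) {δ : ℝ} (hδ : 0 < δ) (hδ' : δ < 2)
    {J K N : ℕ} (hJ : J = ⌈Real.log 4 / (1 / H)⌉₊)
    (hK : K = ⌈Real.log (H / ε) / Real.log 2⌉₊)
    (hN : 578 * H ^ 4 * Real.log (2 / (δ / K / J / Fintype.card (Triple A B))) ≤ N) :
    Ensures law (sHighPrecisionRandVI (unitInput P) ε δ (1 - 1 / H) 1 1 1 H)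
      (20 + Fintype.card S * 2 + K * (Fintype.card (Triple A B) * (5 * Fintype.card S + 3) + 6 +
        J * (Fintype.card (Triple A B) * (4 * N + 48) + 9))) (ENNReal.ofReal δ)
      fun it => ∀ i, |it.w i - φ i| ≤ ε := by
  have hH0 : 0 < H := by linarith
  have hlam0 : 0 ≤ 1 - 1 / H := by rw [sub_nonneg, div_le_one hH0]; exact hH
  have hJpow : (1 - 1 / H) ^ J ≤ 1 / 4 := by
    have h1 : Real.log 4 ≤ J / H := by
      have h2 := Nat.le_ceil (Real.log 4 / (1 / H))
      rw [← hJ, div_div_eq_mul_div, div_one] at h2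
      rwa [le_div_iff₀ hH0]
    calc (1 - 1 / H) ^ J ≤ Real.exp (-(1 / H)) ^ J := by
          gcongr
          linarith [Real.add_one_le_exp (-(1 / H))]
      _ = Real.exp (-(J / H)) := by rw [← Real.exp_nat_mul]; congr 1; ring
      _ ≤ Real.exp (-Real.log 4) := by gcongr
      _ = 1 / 4 := by rw [← Real.log_inv, Real.exp_log (by norm_num), one_div]
  have hKpow : H ≤ ε * 2 ^ K := by
    have h2 := Nat.le_ceil (Real.log (H / ε) / Real.log 2)
    rw [← hK, div_le_iff₀ (Real.log_pos one_lt_two), ← Real.log_pow,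
      Real.log_le_log_iff (by positivity) (by positivity), div_le_iff₀ hε] at h2
    linarith
  unfold sHighPrecisionRandVI
  refine Ensures.mono (T :=
    (Fintype.card S * 2 + 1) + (K * (Fintype.card (Triple A B) * (5 * Fintype.card S + 3) + 3 +
        J * (Fintype.card (Triple A B) * (4 * N + 48) + 9) + 0 + 2 + 1) + 0) + 19) (η := K * ENNReal.ofReal (δ / K)) ?_ ?_
    (natCast_mul_ofReal_div_le hδ.le _) fun _ => id
  · refine Ensures.lit_bind (Ensures.lit_bind (Ensures.lit_bind (Ensures.lit_bind
      (Ensures.times_bind (Ensures.divide_bind (Ensures.logarithm_bind (Ensures.logarithm_bind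
      (Ensures.divide_bind (Ensures.ceiling_bind (Ensures.minus_bind (Ensures.logarithm_bind
      (Ensures.divide_bind (Ensures.ceiling_bind (Ensures.lit_bind (Ensures.divide_bind
      (Ensures.times_bind (Ensures.times_bind (Ensures.divide_bind ?_))))))))))))))))))
    simp only [Nat.cast_zero, Nat.cast_one, Nat.cast_ofNat, mul_one, sub_sub_cancel, ← hK, ← hJ]
    refine Ensures.bind_sure (Ensures.mono (Ensures.tabulateNum_const (η := 0)
      (post := fun i v => v = 0) fun e => Ensures.pure (T := 0) rfl)
      le_rfl (by simp) fun _ => id) fun w0 hw0 => ?_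
    refine (Ensures.bind (η₂ := 0) (T₂ := 0) (Ensures.repeatN (fun k s => s.2 = 1 / 2 ^ k ∧
      ∀ i, |s.1.w i - φ i| ≤ s.2 * φ i) K (fun k s hk hs => ?_) _ ⟨by simp, fun i => ?_⟩)
      fun s hs => Ensures.pure fun i => ?_).mono le_rfl (add_zero _).le fun _ => id
    · obtain ⟨hs2, hs⟩ := hs
      have hK0 : (0 : ℝ) < K := by exact_mod_cast (by omega : 0 < K)
      refine Ensures.divide_bind (Ensures.times_bind ?_)
      have hacc : 1 / H / 4 * (s.2 / 2) = s.2 / 2 / (4 * H) := by field_simp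
      rw [hacc]
      have hs0 : 0 < s.2 := by rw [hs2]; positivity
      refine (Ensures.bind (T₂ := 0) (η₂ := 0) (sRandVI_ensures hP hlaw hH hφ
        (r := s.2 / 2) (by positivity) (fun i => ?_) hJpow (by positivity)
        (lt_of_le_of_lt (div_natCast_le hδ.le _) hδ') hN) fun it hit => Ensures.pure
          ⟨?_, hit⟩).mono le_rfl (add_zero _).le fun _ => id
      · rw [mul_div_cancel₀ _ two_ne_zero]
        exact hs i
      · change s.2 / 2 = _
        rw [hs2, pow_succ, div_div]
    · change |w0 i - φ i| ≤ 1 * φ i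
      rw [hw0, zero_sub, abs_neg, one_mul, abs_of_nonneg (by linarith [hφ.one_le i])]
    · refine (hs.2 i).trans ?_
      rw [hs.1, div_mul_eq_mul_div, one_mul, div_le_iff₀ (by positivity)]
      exact (hφ.le i).trans hKpow
  · exact le_of_eq (by ring)

end Iteration

section RunningTime

theorem log_two_div_div_le {δ : ℝ} (hδ : 0 < δ) (hδ' : δ ≤ 2) (K J N : ℕ) :
    Real.log (2 / (δ / K / J / N)) ≤
      Real.log (2 / δ) + Real.log K + Real.log J + Real.log N := by
  have h0 := log_two_div_nonneg hδ.le hδ'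
  have hK := Real.log_natCast_nonneg K
  have hJ := Real.log_natCast_nonneg J
  have hN := Real.log_natCast_nonneg N
  rcases Nat.eq_zero_or_pos K with rfl | hK'
  · simp; linarith
  rcases Nat.eq_zero_or_pos J with rfl | hJ'
  · simp; linarith
  rcases Nat.eq_zero_or_pos N with rfl | hN'
  · simp; linarith
  have hK'' : (K : ℝ) ≠ 0 := by positivity
  have hJ'' : (J : ℝ) ≠ 0 := by positivity
  have hN'' : (N : ℝ) ≠ 0 := by positivity
  rw [← Real.log_mul (by positivity) hK'', ← Real.log_mul (by positivity) hJ'',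
    ← Real.log_mul (by positivity) hN'']
  refine le_of_eq (congrArg _ ?_)
  field_simp

theorem log_two_bounds : 69 / 100 ≤ Real.log 2 ∧ Real.log 2 ≤ 7 / 10 := by
  have h1 := Real.log_two_gt_d9
  have h2 := Real.log_two_lt_d9
  norm_num at h1 h2
  constructor <;> linarith

theorem log_le_three_mul_log {X F : ℝ} (hX : 2 ≤ X) (hF : X * Real.log 2 ≤ F) :
    Real.log X ≤ 3 * Real.log F := by
  have hF0 : 69 / 100 * X ≤ F := by nlinarith [log_two_bounds.1]
  rw [show (3 : ℝ) * Real.log F = Real.log (F ^ 3) by rw [Real.log_pow]; norm_num]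
  refine Real.log_le_log (by linarith) ?_
  calc X ≤ (69 / 100 * X) ^ 3 := by
        have : (69 / 100 * X) ^ 3 = (69 / 100) ^ 3 * (X ^ 2) * X := by ring
        rw [this]
        have h4 : 4 ≤ X ^ 2 := by nlinarith
        refine le_mul_of_one_le_left (by linarith) ?_
        linarith
    _ ≤ F ^ 3 := by gcongr

/-- The number of steps of the algorithm, for `n` states, `E` triples and `m` answers in the state
`c`, of a reduced problem with `s` states and `E'` triples, as a function of the numbers of phases
`K`, of turns `J` per phase and of samples `N` per estimate. -/
def scalingSteps (n m s E' K J N : ℕ) : ℕ :=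
  (20 + s * 2 + K * (E' * (5 * s + 3) + 6 + J * (E' * (4 * N + 48) + 9)) +
    ((m * (s * 5 + 1 + 2) + 1) + (m * 4 + ((n * (2 + 2) + 1) + 2)))) + 8

theorem scalingSteps_le {n m s E E' K J N : ℕ} (hn : 1 ≤ n) (hE : 1 ≤ E) (hK : 1 ≤ K)
    (hm : m ≤ E) (hs : s ≤ n) (hE' : E' ≤ E) :
    scalingSteps n m s E' K J N ≤ 100 * (K * (n * E + J * (E * (N + 1)))) := by
  unfold scalingSteps
  have h1 : m * s ≤ n * E := (Nat.mul_le_mul hm hs).trans (le_of_eq (mul_comm _ _))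
  have h2 : E' * s ≤ n * E := (Nat.mul_le_mul hE' hs).trans (le_of_eq (mul_comm _ _))
  have h3 : E ≤ n * E := Nat.le_mul_of_pos_left _ hn
  have h4 : n ≤ n * E := Nat.le_mul_of_pos_right _ hE
  have h5 : J * (E' * (4 * N + 48) + 9) ≤ 57 * (J * (E * (N + 1))) := by
    calc J * (E' * (4 * N + 48) + 9) ≤ J * (57 * (E * (N + 1))) := by
          refine Nat.mul_le_mul le_rfl ?_
          have : E' * N ≤ E * N := Nat.mul_le_mul hE' le_rfl
          nlinarith
      _ = _ := by ring
  have h6 : K * (E' * (5 * s + 3) + 6 + J * (E' * (4 * N + 48) + 9)) ≤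
      K * (14 * (n * E) + 57 * (J * (E * (N + 1)))) := by
    refine Nat.mul_le_mul le_rfl ?_
    nlinarith
  have h8 : 1 ≤ n * E := Nat.mul_pos hn hE
  have h9 := Nat.zero_le (K * (J * (E * (N + 1))))
  have h7 : n * E ≤ K * (n * E) := Nat.le_mul_of_pos_left _ hK
  nlinarith

theorem scalingSteps_le_mul_log {n m s E E' K J : ℕ} {H δ F : ℝ} (hn : 1 ≤ n) (hE : 1 ≤ E)
    (hm : m ≤ E) (hs : s ≤ n) (hE' : E' ≤ E) (hH : 1 ≤ H) (hδ : 0 < δ) (hδ' : δ < 1)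
    (hK : K = ⌈Real.log (H / (1 / 4)) / Real.log 2⌉₊) (hJ : J = ⌈Real.log 4 / (1 / H)⌉₊)
    (hF : F = (n * E + E * H ^ 5) * Real.log (2 / δ)) :
    (scalingSteps n m s E' K J ⌈578 * H ^ 4 * Real.log (2 / (δ / K / J / E'))⌉₊ : ℝ) ≤
      10 ^ 10 * F * Real.log F ^ 2 := by
  have hnR : (1 : ℝ) ≤ n := by exact_mod_cast hn
  have hER : (1 : ℝ) ≤ E := by exact_mod_cast hE
  have hE'R : (E' : ℝ) ≤ E := by exact_mod_cast hE'
  obtain ⟨hl2, hl2'⟩ := log_two_bounds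
  have hl4 : Real.log 4 = 2 * Real.log 2 := by
    rw [show (4 : ℝ) = 2 ^ 2 by norm_num, Real.log_pow]; norm_num
  set l := Real.log (2 / δ) with hl
  have hl_ge : Real.log 2 ≤ l := by
    refine Real.log_le_log two_pos ?_
    rw [le_div_iff₀ hδ]; linarith
  have hH5 : H ≤ H ^ 5 := le_self_pow₀ hH (by norm_num)
  set X : ℝ := n * E + E * H ^ 5 with hX
  have hnE : 1 ≤ (n : ℝ) * E := one_le_mul_of_one_le_of_one_le hnR hER
  have hEH : (E : ℝ) ≤ E * H ^ 5 := le_mul_of_one_le_right (by linarith) (hH.trans hH5)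
  have hHE : H ≤ E * H ^ 5 := hH5.trans (le_mul_of_one_le_left (by positivity) hER)
  have hX2 : 2 ≤ X := by linarith
  set y := Real.log F with hy
  have hXy : Real.log X ≤ 3 * y := log_le_three_mul_log hX2 (by rw [hF]; gcongr)
  have hy_ge : 23 / 100 ≤ y := by
    have := Real.log_le_log two_pos hX2
    linarith
  have hy0 : 0 ≤ y := by linarith
  have hl0 : 0 ≤ l := by linarith
  have hlogE : Real.log E ≤ 3 * y :=
    (Real.log_le_log (by linarith) (by linarith)).trans hXy
  have hlogH : Real.log H ≤ 3 * y :=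
    (Real.log_le_log (by linarith) (by linarith)).trans hXy
  have hlogH0 := Real.log_nonneg hH
  have hlogE' : Real.log E' ≤ 3 * y := by
    rcases Nat.eq_zero_or_pos E' with h | h
    · simp only [h, Nat.cast_zero, Real.log_zero]; linarith
    · exact (Real.log_le_log (by exact_mod_cast h) hE'R).trans hlogE
  have hKle : (K : ℝ) ≤ 18 * y := by
    have h4H : Real.log (H / (1 / 4)) = Real.log H + 2 * Real.log 2 := by
      rw [div_div_eq_mul_div, div_one, Real.log_mul (by positivity) (by norm_num), hl4]
    have h1 : Real.log (H / (1 / 4)) / Real.log 2 ≤ 2 + Real.log H * (145 / 100) := by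
      rw [h4H, div_le_iff₀ (by linarith)]
      nlinarith
    have h2 : 0 ≤ Real.log (H / (1 / 4)) / Real.log 2 := by
      rw [h4H]; exact div_nonneg (by linarith) (by linarith)
    have h3 := Nat.ceil_lt_add_one h2
    rw [← hK] at h3
    linarith
  have hK1 : 1 ≤ K := by
    rw [hK]
    refine Nat.ceil_pos.mpr (div_pos (Real.log_pos ?_) (by linarith))
    linarith
  have hJ0 : 0 < Real.log 4 / (1 / H) := by
    rw [hl4]; exact div_pos (by linarith) (by positivity)
  have hJ1 : 1 ≤ J := by rw [hJ]; exact Nat.ceil_pos.mpr hJ0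
  have hJle : (J : ℝ) ≤ 3 * H := by
    have h3 := Nat.ceil_lt_add_one hJ0.le
    rw [← hJ, div_div_eq_mul_div, div_one, hl4] at h3
    nlinarith
  have hlogK : Real.log K ≤ 18 * y := by
    have := Real.log_le_sub_one_of_pos (x := K) (by exact_mod_cast hK1)
    linarith
  have hlogJ : Real.log J ≤ 10 * y := by
    have h1 := Real.log_le_log (by exact_mod_cast hJ1) hJle
    rw [Real.log_mul (by norm_num) (by positivity)] at h1
    have h2 := Real.log_le_log (by norm_num) (by norm_num : (3 : ℝ) ≤ 4)
    linarith
  have hly : 1 ≤ 7 * (l * y) := by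
    have : 69 / 100 * (23 / 100) ≤ l * y := by
      refine mul_le_mul ?_ hy_ge (by norm_num) (by linarith)
      linarith
    linarith
  have hlog : Real.log (2 / (δ / K / J / E')) ≤ 50 * (l * y) := by
    have h1 := log_two_div_div_le hδ (by linarith) K J E'
    have h2 : l * (23 / 100) ≤ l * y := by gcongr
    have h3 : 69 / 100 * y ≤ l * y := by gcongr; linarith
    linarith
  set N := ⌈578 * H ^ 4 * Real.log (2 / (δ / K / J / E'))⌉₊ with hN
  have hH4 : 1 ≤ H ^ 4 := one_le_pow₀ hH
  have hN1 : (N : ℝ) + 1 ≤ 29000 * (H ^ 4 * (l * y)) := by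
    have hx0 : 0 ≤ 578 * H ^ 4 * Real.log (2 / (δ / K / J / E')) := by
      refine mul_nonneg (by positivity) (log_two_div_nonneg (by positivity) ?_)
      exact (div_natCast_le (by positivity) _).trans ((div_natCast_le (by positivity) _).trans
        ((div_natCast_le hδ.le _).trans (by linarith)))
    have h1 := Nat.ceil_lt_add_one hx0
    rw [← hN] at h1
    have h2 : 578 * H ^ 4 * Real.log (2 / (δ / K / J / E')) ≤ 578 * H ^ 4 * (50 * (l * y)) := by
      gcongr
    have h3 : l * y ≤ H ^ 4 * (l * y) := le_mul_of_one_le_left (by linarith) hH4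
    linarith
  have hly0 : 0 ≤ l * y := by linarith
  have hmain : (n * E + J * (E * (N + 1)) : ℝ) ≤ 87000 * (F * y) := by
    calc (n * E + J * (E * (N + 1)) : ℝ)
        ≤ n * E * (7 * (l * y)) + 3 * H * (E * (29000 * (H ^ 4 * (l * y)))) := by
          refine add_le_add (le_mul_of_one_le_right (by positivity) hly) ?_
          gcongr
      _ ≤ 87000 * (n * E * (l * y)) + 87000 * (E * H ^ 5 * (l * y)) := by
          have : 0 ≤ n * E * (l * y) := by positivity
          have h2 : 3 * H * (E * (29000 * (H ^ 4 * (l * y)))) = 87000 * (E * H ^ 5 * (l * y)) := by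
            ring
          linarith
      _ = 87000 * (F * y) := by rw [hF]; ring
  have hF0 : 0 ≤ F * y := by
    have : 0 ≤ (n * E + J * (E * (N + 1)) : ℝ) := by positivity
    linarith
  have hsteps : (scalingSteps n m s E' K J N : ℝ) ≤ 100 * (K * (n * E + J * (E * (N + 1)))) := by
    exact_mod_cast scalingSteps_le hn hE hK1 hm hs hE'
  calc (scalingSteps n m s E' K J N : ℝ) ≤ 100 * (K * (n * E + J * (E * (N + 1)))) := hsteps
    _ ≤ 100 * (18 * y * (87000 * (F * y))) := by gcongr
    _ ≤ 10 ^ 10 * F * y ^ 2 := by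
        have := mul_nonneg hF0 hy0
        have h2 : 100 * (18 * y * (87000 * (F * y))) = 156600000 * (F * y * y) := by ring
        have h3 : 10 ^ 10 * F * y ^ 2 = 10 ^ 10 * (F * y * y) := by ring
        rw [h2, h3]
        gcongr
        norm_num

end RunningTime

theorem exists_policies {S : Type} {A : S → Type} {B : ∀ i, A i → Type} [∀ i, Nonempty (A i)]
    [∀ i a, Nonempty (B i a)] (i : S) (ab : Σ a : A i, B i a) :
    ∃ π : MinPolicy A × MaxPolicy A B, (⟨π.1 i, π.2 ⟨i, π.1 i⟩⟩ : Σ a : A i, B i a) = ab := by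
  classical
  obtain ⟨a, b⟩ := ab
  have key : ∀ τ : MaxPolicy A B, τ ⟨i, a⟩ = b → ∀ a', a' = a →
      (⟨a', τ ⟨i, a'⟩⟩ : Σ a : A i, B i a) = ⟨a, b⟩ := by
    rintro τ rfl _ rfl
    rfl
  let σ : MinPolicy A := Function.update (fun _ => Classical.arbitrary _) i a
  let τ : MaxPolicy A B := Function.update (β := fun ia : (Σ i, A i) => B ia.1 ia.2)
    (fun _ => Classical.arbitrary _) ⟨i, a⟩ b
  exact ⟨(σ, τ), key τ (Function.update_self ..) (σ i) (Function.update_self ..)⟩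

section Hitting

open Prog

variable {S : Type} [Fintype S] [DecidableEq S] {A : S → Type} {B : ∀ i, A i → Type}

theorem update_zero_dotProduct (p φ : S → ℝ) (c : S) :
    Function.update p c 0 ⬝ᵥ φ = ∑ j : OtherState c, p j * φ j := by
  rw [dotProduct, ← Finset.sum_subtype (Finset.univ.erase c) (by simp) fun j => p j * φ j,
    ← Finset.sum_erase_add _ _ (Finset.mem_univ c), Function.update_self, zero_mul, add_zero]
  refine Finset.sum_congr rfl fun j hj => ?_
  rw [Function.update_of_ne (Finset.ne_of_mem_erase hj)]

theorem deflate_mulVec (M : Matrix S S ℝ) (c : S) (φ : S → ℝ) (i : S) :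
    (deflate M c).mulVec φ i = ∑ j : OtherState c, M i j * φ j := by
  rw [← update_zero_dotProduct, Matrix.mulVec, deflate]
  congr 1

namespace MeanPayoffGame

variable {g : MeanPayoffGame S A B} {c : S} {φ : S → ℝ}

theorem sum_other_le_one (g : MeanPayoffGame S A B) (c : S) (e : Triple A B) :
    ∑ j : OtherState c, g.P e j ≤ 1 := by
  rw [← g.P_sum e, ← Finset.sum_subtype (Finset.univ.erase c) (by simp) fun j => g.P e j]
  exact Finset.sum_le_sum_of_subset_of_nonneg (Finset.subset_univ _) fun j _ _ => g.P_nonneg _ _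

theorem sum_mul_le_add (g : MeanPayoffGame S A B) (c : S) (e : Triple A B) {w v : OtherState c → ℝ}
    {ε : ℝ} (hε : 0 ≤ ε) (h : ∀ j, w j ≤ v j + ε) :
    ∑ j : OtherState c, g.P e j * w j ≤ ∑ j : OtherState c, g.P e j * v j + ε := by
  calc ∑ j : OtherState c, g.P e j * w j ≤ ∑ j : OtherState c, g.P e j * (v j + ε) :=
        Finset.sum_le_sum fun j _ => mul_le_mul_of_nonneg_left (h j) (g.P_nonneg _ _)
    _ = ∑ j : OtherState c, g.P e j * v j + (∑ j : OtherState c, g.P e j) * ε := by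
        simp only [mul_add, Finset.sum_add_distrib, Finset.sum_mul]
    _ ≤ _ := by
        gcongr
        exact mul_le_of_le_one_left hε (g.sum_other_le_one c e)

variable [∀ i, Fintype (A i)] [∀ i a, Fintype (B i a)] [∀ i, Nonempty (A i)]
  [∀ i a, Nonempty (B i a)]

theorem isScaling_iff : g.IsScaling c φ ↔
    ∀ e : Triple A B, 1 + ∑ j : OtherState c, g.P e j * φ j ≤ φ e.1 := by
  unfold IsScaling
  simp only [update_zero_dotProduct]
  constructor
  · rintro h ⟨i, ab⟩
    have := le_ciSup (Set.finite_range fun ab : (Σ a : A i, B i a) =>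
      ∑ j : OtherState c, g.P ⟨i, ab⟩ j * φ j).bddAbove ab
    linarith [h i]
  · intro h i
    have : ⨆ ab : (Σ a : A i, B i a), ∑ j : OtherState c, g.P ⟨i, ab⟩ j * φ j ≤ φ i - 1 :=
      ciSup_le fun ab => le_sub_iff_add_le'.mpr (h ⟨i, ab⟩)
    linarith

namespace IsHittingVector

theorem one_add_le (hφ : g.IsHittingVector c φ) (e : Triple A B) :
    1 + ∑ j : OtherState c, g.P e j * φ j ≤ φ e.1 := by
  classical
  obtain ⟨i, ab⟩ := e
  obtain ⟨π, hπ⟩ := exists_policies i ab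
  have h := le_ciSup (Set.finite_range fun π : MinPolicy A × MaxPolicy A B =>
    (deflate (g.transition π.1 π.2) c).mulVec φ i).bddAbove π
  rw [deflate_mulVec] at h
  simp only [transition, Matrix.of_apply, hπ] at h
  have h2 := hφ i
  simp only [transition] at h2
  simp only
  linarith

theorem attained (hφ : g.IsHittingVector c φ) (i : S) : ∃ ab, φ i = 1 + ∑ j : OtherState c, g.P ⟨i, ab⟩ j * φ j := by
  obtain ⟨π, hπ⟩ := exists_eq_ciSup_of_finite (f := fun π : MinPolicy A × MaxPolicy A B =>
    (deflate (g.transition π.1 π.2) c).mulVec φ i)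
  refine ⟨⟨π.1 i, π.2 ⟨i, π.1 i⟩⟩, ?_⟩
  rw [hφ i, ← hπ, deflate_mulVec]
  rfl

theorem one_le (hφ : g.IsHittingVector c φ) (i : S) : 1 ≤ φ i := by
  have : Nonempty S := ⟨i⟩
  obtain ⟨i₀, h₀⟩ := Finite.exists_min φ
  have key : ∀ e, 0 ≤ ∑ j : OtherState c, g.P e j * φ j + max (-φ i₀) 0 := fun e => by
    simpa using g.sum_mul_le_add c e (w := 0) (v := fun j => φ j) (le_max_right (-φ i₀) 0)
      fun j => by
        have := h₀ j
        have := le_max_left (-φ i₀) 0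
        simp only [Pi.zero_apply]
        linarith
  have e : ∀ i, ∃ e : Triple A B, e.1 = i := fun i =>
    ⟨⟨i, Classical.arbitrary _, Classical.arbitrary _⟩, rfl⟩
  obtain ⟨e₀, rfl⟩ := e i₀
  obtain ⟨e, rfl⟩ := e i
  have h1 := hφ.one_add_le e₀
  have h2 := hφ.one_add_le e
  have hpos : 0 ≤ φ e₀.1 := by
    by_contra! h
    have h3 := key e₀
    rw [max_eq_left (by linarith)] at h3
    linarith
  have h3 := key e
  rw [max_eq_right (by linarith)] at h3
  linarith

theorem isValueVector (hφ : g.IsHittingVector c φ) {H : ℝ} (hH : ‖φ‖ ≤ H) :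
    IsValueVector (reducedTable g.P c) H fun i : OtherState c => φ i where
  one_le i := hφ.one_le i
  le i := (le_abs_self _).trans ((norm_le_pi_norm φ i).trans hH)
  one_add_le e := hφ.one_add_le ⟨e.1.1, e.2.2⟩
  attained i := by
    obtain ⟨ab, h⟩ := hφ.attained i
    exact ⟨(), ab, h⟩

end IsHittingVector

end MeanPayoffGame

end Hitting

section Scaling

open Prog

variable {S : Type} [Fintype S] [DecidableEq S]
  {A : S → Type} [∀ i, Fintype (A i)] [∀ i, Nonempty (A i)]
  {B : ∀ i, A i → Type} [∀ i a, Fintype (B i a)] [∀ i a, Nonempty (B i a)]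
  {g : MeanPayoffGame S A B} {c : S} {φ : S → ℝ}

theorem one_div_one_sub_rateOf (h : ℝ) : 1 / (1 - rateOf h) = h := by
  simp [rateOf]

/-- Twice an approximation of the hitting vector up to `1 / 4` is a scaling vector. -/
theorem MeanPayoffGame.IsHittingVector.scaling_of_approx (hφ : g.IsHittingVector c φ) {H : ℝ}
    (hH : ‖φ‖ ≤ H) {w : OtherState c → ℝ} (hw : ∀ i, |w i - φ i| ≤ 1 / 4) {x : ℝ}
    (hle : ∀ ab, 1 + ∑ j : OtherState c, g.P ⟨c, ab⟩ j * w j ≤ x)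
    (hex : ∃ ab, x = 1 + ∑ j : OtherState c, g.P ⟨c, ab⟩ j * w j) {z : S → ℝ}
    (hzc : z c = 2 * x) (hz : ∀ i : OtherState c, z i = 2 * w i) :
    (∀ i, 0 ≤ z i) ∧ g.IsScaling c z ∧ 1 / (1 - rateOf ‖z‖) ≤ 2 / (1 - rateOf H) + 1 / 2 := by
  have hx : |x - φ c| ≤ 1 / 4 := by
    rw [abs_le]
    constructor
    · obtain ⟨ab, hab⟩ := hφ.attained c
      have h1 := g.sum_mul_le_add c ⟨c, ab⟩ (w := fun j => φ j) (v := w) (ε := 1 / 4)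
        (by norm_num) fun j => by have := abs_le.mp (hw j); linarith
      have h2 := hle ab
      linarith
    · obtain ⟨ab, hab⟩ := hex
      have h1 := g.sum_mul_le_add c ⟨c, ab⟩ (w := w) (v := fun j => φ j) (ε := 1 / 4)
        (by norm_num) fun j => by have := abs_le.mp (hw j); linarith
      have h2 := hφ.one_add_le ⟨c, ab⟩
      simp only at h2
      linarith
  have hzφ : ∀ i, |z i / 2 - φ i| ≤ 1 / 4 := fun i => by
    by_cases hi : i = c
    · subst hi
      rwa [hzc, mul_div_cancel_left₀ _ two_ne_zero]
    · have h := hz ⟨i, hi⟩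
      have h' := hw ⟨i, hi⟩
      simp only at h h'
      rwa [h, mul_div_cancel_left₀ _ two_ne_zero]
  have hz0 : ∀ i, 0 ≤ z i := fun i => by
    have := abs_le.mp (hzφ i)
    linarith [hφ.one_le i]
  refine ⟨hz0, MeanPayoffGame.isScaling_iff.mpr fun e => ?_, ?_⟩
  · have h1 := g.sum_mul_le_add c e (w := fun j => z j / 2) (v := fun j => φ j) (ε := 1 / 4)
      (by norm_num) fun j => by have := abs_le.mp (hzφ j); linarith
    have h2 := hφ.one_add_le e
    have h3 := abs_le.mp (hzφ e.1)
    simp only [mul_div_assoc', ← Finset.sum_div] at h1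
    linarith
  · rw [one_div_one_sub_rateOf, ← mul_one_div, one_div_one_sub_rateOf]
    have hH0 : 0 ≤ H := (norm_nonneg _).trans hH
    refine (pi_norm_le_iff_of_nonneg (by positivity)).mpr fun i => ?_
    rw [Real.norm_eq_abs, abs_of_nonneg (hz0 i)]
    have h1 := abs_le.mp (hzφ i)
    have h2 := (le_abs_self _).trans ((norm_le_pi_norm φ i).trans hH)
    linarith

variable [∀ i, DecidableEq (A i)] [∀ i a, DecidableEq (B i a)]

theorem computeScaling_ensures (hφ : g.IsHittingVector c φ) {H : ℝ} (hH : ‖φ‖ ≤ H) {δ : ℝ}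
    (hδ : 0 < δ) (hδ' : δ < 1) {J K N : ℕ} (hJ : J = ⌈Real.log 4 / (1 / H)⌉₊)
    (hK : K = ⌈Real.log (H / (1 / 4)) / Real.log 2⌉₊)
    (hN : 578 * H ^ 4 * Real.log (2 / (δ / K / J / Fintype.card (RedTriple A B c))) ≤ N) :
    Ensures (g.reducedLaw c) (computeScaling g.P c H δ)
      (scalingSteps (Fintype.card S) (Fintype.card (Σ a : A c, B c a))
        (Fintype.card (OtherState c)) (Fintype.card (RedTriple A B c)) K J N) (ENNReal.ofReal δ)
      fun z => (∀ i, 0 ≤ z i) ∧ g.IsScaling c z ∧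
        1 / (1 - rateOf ‖z‖) ≤ 2 / (1 - rateOf H) + 1 / 2 := by
  have hH1 : 1 ≤ H := (hφ.one_le c).trans ((le_abs_self _).trans ((norm_le_pi_norm φ c).trans hH))
  unfold computeScaling scalingSteps
  refine Ensures.lit_bind (Ensures.lit_bind (Ensures.lit_bind (Ensures.divide_bind
    (Ensures.divide_bind (Ensures.minus_bind (Ensures.minus_bind (Ensures.divide_bind ?_)))))))
  simp only [Nat.cast_one, Nat.cast_ofNat, sub_sub_cancel, one_div_one_div]
  refine (Ensures.bind (η₂ := 0) (sHighPrecisionRandVI_ensures (P := reducedTable g.P c)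
    (law := g.reducedLaw c) (fun _ _ => g.P_nonneg _ _) (fun e j => rfl) hH1
    (hφ.isValueVector hH) (ε := 1 / 4) (by norm_num) hδ (by linarith) hJ hK hN)
    fun it hit => ?_).mono le_rfl (add_zero _).le fun _ => id
  refine Ensures.bind_sure (Ensures.mono (Ensures.tabulateNum_const (η := 0)
    (post := fun ab v => v = ∑ j : OtherState c, g.P ⟨c, ab⟩ j * it.w j)
    fun ab => Ensures.dot _ _) le_rfl (by simp) fun _ => id) fun q hq => ?_
  refine Ensures.bind_sure (Ensures.argMax q) fun best hbest => ?_
  refine Ensures.read_bind (Ensures.plus_bind ?_)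
  refine (Ensures.tabulateNum_const (η := 0) (post := fun i v =>
    v = 2 * if hi : i = c then 1 + q best else it.w ⟨i, hi⟩) fun i => ?_).mono le_rfl (by simp)
      fun z hz => ?_
  · by_cases hi : i = c
    · simp only [hi, dite_true]
      exact Ensures.times rfl
    · simp only [hi, dite_false]
      exact Ensures.read_bind (Ensures.times (T := 0) rfl)
  · refine hφ.scaling_of_approx hH hit (x := 1 + q best) (fun ab => ?_) ⟨best, by rw [hq]⟩
      (by simp [hz]) fun i => by simp [hz, i.2]
    rw [← hq]
    linarith [hbest ab]

end Scaling

theorem mainTheorem9 :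
    ∃ (C : ℝ) (p : ℕ), 0 < C ∧
      ∀ (S : Type) [Fintype S] [DecidableEq S]
        (A : S → Type) [∀ i, Fintype (A i)] [∀ i, DecidableEq (A i)] [∀ i, Nonempty (A i)]
        (B : ∀ i, A i → Type) [∀ i a, Fintype (B i a)] [∀ i a, DecidableEq (B i a)]
        [∀ i a, Nonempty (B i a)]
        (g : MeanPayoffGame S A B) (c : S)
        (φstar : S → ℝ) (_ : g.IsHittingVector c φstar)
        (H : ℝ) (_ : ‖φstar‖ ≤ H)
        (δ : ℝ) (_ : 0 < δ) (_ : δ < 1) (F : ℝ)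
        (_ : F = ((Fintype.card S : ℝ) * (Fintype.card (Triple A B) : ℝ)
            + (Fintype.card (Triple A B) : ℝ) / (1 - rateOf H) ^ 5) * Real.log (2 / δ)),
        ENNReal.ofReal (1 - δ) ≤ (g.scalingLaw c H δ).toOuterMeasure
          {z : (S → ℝ) × ℕ | (∀ i, 0 ≤ z.1 i) ∧ g.IsScaling c z.1 ∧
            1 / (1 - rateOf ‖z.1‖) ≤ 2 / (1 - rateOf H) + 1 / 2 ∧
            (z.2 : ℝ) ≤ C * F * Real.log F ^ p} := by
  refine ⟨10 ^ 10, 2, by norm_num, ?_⟩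
  intro S _ _ A _ _ _ B _ _ _ g c φ hφ H hH δ hδ hδ' F hF
  have hH1 : 1 ≤ H := (hφ.one_le c).trans ((le_abs_self _).trans ((norm_le_pi_norm φ c).trans hH))
  have hens := computeScaling_ensures hφ hH hδ hδ' rfl rfl (Nat.le_ceil _)
  have hF' : F = (Fintype.card S * Fintype.card (Triple A B) +
      Fintype.card (Triple A B) * H ^ 5) * Real.log (2 / δ) := by
    rw [hF, div_eq_mul_one_div, ← one_div_pow, one_div_one_sub_rateOf]
  have hm : Fintype.card (Σ a : A c, B c a) ≤ Fintype.card (Triple A B) :=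
    Fintype.card_le_of_injective (fun ab => (⟨c, ab⟩ : Triple A B)) fun _ _ h =>
      sigma_mk_injective (β := fun i => Σ a : A i, B i a) h
  have hE' : Fintype.card (RedTriple A B c) ≤ Fintype.card (Triple A B) := by
    refine Fintype.card_le_of_injective (fun e => ⟨e.1.1, e.2.2⟩) ?_
    rintro ⟨⟨i, hi⟩, ⟨⟩, ab⟩ ⟨⟨j, hj⟩, ⟨⟩, ab'⟩ h
    obtain ⟨rfl, h⟩ := Sigma.mk.inj h
    obtain rfl := eq_of_heq h
    rfl
  have hn : 1 ≤ Fintype.card S := Fintype.card_pos_iff.mpr ⟨c⟩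
  have hE : 1 ≤ Fintype.card (Triple A B) :=
    Fintype.card_pos_iff.mpr ⟨⟨c, Classical.arbitrary _, Classical.arbitrary _⟩⟩
  have hsteps := scalingSteps_le_mul_log hn hE hm (Fintype.card_subtype_le fun i => i ≠ c) hE' hH1
    hδ hδ' rfl rfl hF'
  exact hens.le_toOuterMeasure hδ.le fun z t hz ht =>
    ⟨hz.1, hz.2.1, hz.2.2, (Nat.cast_le.mpr ht).trans hsteps⟩
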